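/- Let $n\ge 0$ be an integer, let $\mathfrak{gl}_n=\mathfrak{gl}_n(\mathbb{C})$ with matrix units $E_{ij}$, and let $X=(x_{ij})_{1\le i,j\le n}$ be a matrix of commuting variables. For $\alpha\in\mathbb{C}$ the $\alpha$-determinant of $X$ is $$\det\nolimits^{(\alpha)}(X)=\sum_{\sigma\in\mathfrak{S}_n}\alpha^{\,n-\nu(\sigma)}\prod_{i=1}^n x_{i\sigma(i)},$$ where $\nu(\sigma)$ is the number of cycles of $\sigma$, fixed points included (and $0^0=1$). The Lie algebra $\mathfrak{gl}_n$ acts on the polynomial ring $\mathbb{C}[x_{ij}]$ by $\rho(E_{ij})=\sum_{k=1}^n x_{ik}\,\partial/\partial x_{jk}$; put $$V_n^{(\alpha)}=\rho(U(\mathfrak{gl}_n))\det\nolimits^{(\alpha)}(X),$$ the cyclic $U(\mathfrak{gl}_n)$-module generated by the $\alpha$-determinant. For a partition $\lambda\vdash n$ with conjugate $\lambda'$, let $f^\lambda$ be the number of standard tableaux of shape $\lambda$, and let $E^\lambda$ be the Schur module of $\mathfrak{gl}_n$, that is, the image of the Young symmetrizer $\sum_{q}\sum_{p}\operatorname{sgn}(q)\,qp$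 of a numbering of the boxes of $\lambda$ ($q$ in its column group, $p$ in its row group), acting by permutation of the tensor factors on $(\mathbb{C}^n)^{\otimes n}$. All isomorphisms below are isomorphisms of $\mathfrak{gl}_n$-modules, and $\mathfrak{gl}_n$ acts on $(\mathbb{C}^n)^{\otimes n}$ by the $n$-th tensor power of its natural representation. For $k=1,2,\dots,n-1$, $$V_n^{(1/k)}\cong\bigoplus_{\lambda\vdash n,\ \lambda_1'\le k}(E^\lambda)^{\oplus f^\lambda}\qquad\text{and}\qquad V_n^{(-1/k)}\cong\bigoplus_{\lambda\vdash n,\ \lambda_1\le k}(E^\lambda)^{\oplus f^\lambda}.$$ For every $\alpha\in\mathbb{C}\setminus\{\pm1,\pm\tfrac12,\dots,\pm\tfrac1{n-1}\}$, $$V_n^{(\alpha)}\cong(\mathbb{C}^n)^{\otimes n}\cong\bigoplus_{\lambda\vdash n}(E^\lambda)^{\oplus f^\lambda}.$$ -/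

import Mathlib

open scoped TensorProduct DirectSum

attribute [local instance 100] LieRing.ofAssociativeRing

namespace AlphaDet

/-- The general linear Lie algebra `𝔤𝔩ₙ(ℂ)`, with the commutator bracket. -/
abbrev gl (n : ℕ) : Type := Matrix (Fin n) (Fin n) ℂ

/-! ### The polynomial representation and the cyclic module -/

/-- The ring of polynomials in the variables `x i j`. -/
abbrev Poly (n : ℕ) : Type := MvPolynomial (Fin n × Fin n) ℂ

/-- The number of cycles of a permutation, fixed points included. -/
def numCycles {n : ℕ} (σ : Equiv.Perm (Fin n)) : ℕ := σ.partition.parts.card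

/-- The `α`-determinant of a square matrix over a commutative `ℂ`-algebra. -/
noncomputable def alphaDet {n : ℕ} {A : Type*} [CommRing A] [Algebra ℂ A] (α : ℂ)
    (M : Matrix (Fin n) (Fin n) A) : A :=
  ∑ σ : Equiv.Perm (Fin n), α ^ (n - numCycles σ) • ∏ i, M i (σ i)

/-- The derivation `∑ᵢⱼ Aᵢⱼ ∑ₖ xᵢₖ ∂ⱼₖ` of the polynomial ring. -/
noncomputable def polyDer {n : ℕ} (A : gl n) : Derivation ℂ (Poly n) (Poly n) :=
  ∑ i, ∑ j, A i j • ∑ k, (MvPolynomial.X (i, k) : Poly n) • MvPolynomial.pderiv (j, k)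

theorem derivation_sum_apply {n : ℕ} (D : Fin n → Derivation ℂ (Poly n) (Poly n)) (p : Poly n) :
    (∑ i, D i) p = ∑ i, D i p := by
  have h := map_sum (Derivation.coeFnAddMonoidHom (R := ℂ) (A := Poly n) (M := Poly n)) D
    Finset.univ
  simp only [Derivation.coeFnAddMonoidHom_apply] at h
  rw [h, Finset.sum_apply]

theorem polyDer_X {n : ℕ} (A : gl n) (a b : Fin n) :
    polyDer A (MvPolynomial.X (a, b)) = ∑ i, A i a • (MvPolynomial.X (i, b) : Poly n) := by
  simp only [polyDer, derivation_sum_apply, Derivation.coe_smul, Pi.smul_apply,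
    MvPolynomial.pderiv_X, smul_eq_mul]
  refine Finset.sum_congr rfl fun i _ => ?_
  rw [Finset.sum_eq_single a]
  · congr 1
    rw [Finset.sum_eq_single b]
    · simp
    · intro k _ hk
      simp [hk.symm]
    · simp
  · intro j _ hj
    rw [Finset.sum_eq_zero, smul_zero]
    intro k _
    simp [hj.symm]
  · simp

/-- The representation `ρ` of `𝔤𝔩ₙ(ℂ)` on polynomials, `ρ(Eᵢⱼ) = ∑ₖ xᵢₖ ∂ⱼₖ`. -/
noncomputable def rho (n : ℕ) : gl n →ₗ⁅ℂ⁆ Module.End ℂ (Poly n) where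
  toFun A := (polyDer A : Poly n →ₗ[ℂ] Poly n)
  map_add' A B := by
    rw [← Derivation.coe_add_linearMap]
    congr 1
    refine MvPolynomial.derivation_ext fun ⟨a, b⟩ => ?_
    simp [polyDer_X, add_smul, Finset.sum_add_distrib]
  map_smul' c A := by
    rw [RingHom.id_apply, ← Derivation.coe_smul_linearMap]
    congr 1
    refine MvPolynomial.derivation_ext fun ⟨a, b⟩ => ?_
    simp [polyDer_X, mul_smul, Finset.smul_sum]
  map_lie' := by
    intro A B
    have h : polyDer ⁅A, B⁆ = ⁅polyDer A, polyDer B⁆ := by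
      refine MvPolynomial.derivation_ext fun ⟨a, b⟩ => ?_
      simp only [Derivation.commutator_apply, polyDer_X, map_sum, Derivation.map_smul,
        Finset.smul_sum, smul_smul, Ring.lie_def, Matrix.sub_apply, Matrix.mul_apply, sub_smul,
        Finset.sum_sub_distrib, Finset.sum_smul]
      congr 1
      · rw [Finset.sum_comm]
        exact Finset.sum_congr rfl fun i _ => Finset.sum_congr rfl fun j _ => by rw [mul_comm]
      · rw [Finset.sum_comm]
        exact Finset.sum_congr rfl fun i _ => Finset.sum_congr rfl fun j _ => by rw [mul_comm]
    rw [h]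
    ext1 p
    rfl

noncomputable instance (n : ℕ) : LieRingModule (gl n) (Poly n) :=
  LieRingModule.compLieHom (Poly n) (rho n)

instance (n : ℕ) : LieModule ℂ (gl n) (Poly n) :=
  LieModule.compLieHom (Poly n) (rho n)

/-- The cyclic module `V_n^{(α)} = ρ(U(𝔤𝔩ₙ)) det^{(α)}(X)`, where `X = (x i j)`. -/
noncomputable def cyclicModule (n : ℕ) (α : ℂ) : LieSubmodule ℂ (gl n) (Poly n) where
  carrier := {p | ∃ u : UniversalEnvelopingAlgebra ℂ (gl n),
    UniversalEnvelopingAlgebra.lift ℂ (rho n) u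
      (alphaDet α (Matrix.mvPolynomialX (Fin n) (Fin n) ℂ)) = p}
  add_mem' := by
    rintro _ _ ⟨u, rfl⟩ ⟨v, rfl⟩
    exact ⟨u + v, by simp⟩
  zero_mem' := ⟨0, by simp⟩
  smul_mem' := by
    rintro c _ ⟨u, rfl⟩
    exact ⟨c • u, by simp⟩
  lie_mem := by
    rintro A _ ⟨u, rfl⟩
    refine ⟨UniversalEnvelopingAlgebra.ι ℂ A * u, ?_⟩
    rw [map_mul, UniversalEnvelopingAlgebra.lift_ι_apply]
    rfl

/-! ### Tensor powers of the natural representation -/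

/-- The tensor power of `ℂⁿ` with factors indexed by `ι`. -/
abbrev Tensor (n : ℕ) (ι : Type) : Type := ⨂[ℂ] _ : ι, (Fin n → ℂ)

theorem commutator_sum {R ι : Type*} [Ring R] [Fintype ι] [DecidableEq ι] (a b c : ι → R)
    (h : ∀ k, c k + b k * a k = a k * b k) (hc : ∀ k l, k ≠ l → a k * b l = b l * a k) :
    ∑ k, c k = ⁅∑ k, a k, ∑ k, b k⁆ := by
  rw [Ring.lie_def, Finset.sum_mul_sum, Finset.sum_mul_sum,
    Finset.sum_comm (f := fun i j => b i * a j), ← Finset.sum_sub_distrib]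
  refine Finset.sum_congr rfl fun k _ => ?_
  rw [← Finset.sum_sub_distrib, Finset.sum_eq_single k]
  · exact eq_sub_of_add_eq (h k)
  · exact fun l _ hl => sub_eq_zero.mpr (hc k l hl.symm)
  · simp

/-- The action of `𝔤𝔩ₙ(ℂ)` on a tensor power of `ℂⁿ`: the matrix `A` acts as
`∑ₖ 1 ⊗ ⋯ ⊗ A ⊗ ⋯ ⊗ 1`, with `A` in the place `k`. -/
noncomputable def tensorRep (n : ℕ) (ι : Type) [Fintype ι] [DecidableEq ι] :
    gl n →ₗ⁅ℂ⁆ Module.End ℂ (Tensor n ι) where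
  toFun A := ∑ k : ι, PiTensorProduct.map
    (Pi.mulSingle k (Matrix.toLin' A) : ι → Module.End ℂ (Fin n → ℂ))
  map_add' A B := by
    rw [← Finset.sum_add_distrib]
    refine Finset.sum_congr rfl fun k _ => ?_
    rw [map_add]
    exact PiTensorProduct.map_update_add _ k _ _
  map_smul' c A := by
    rw [RingHom.id_apply, Finset.smul_sum]
    refine Finset.sum_congr rfl fun k _ => ?_
    rw [map_smul]
    exact PiTensorProduct.map_update_smul _ k _ _
  map_lie' := by
    intro A B
    refine commutator_sum (R := Module.End ℂ (Tensor n ι)) (ι := ι)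
      (fun k => PiTensorProduct.map (Pi.mulSingle k (Matrix.toLin' A)))
      (fun k => PiTensorProduct.map (Pi.mulSingle k (Matrix.toLin' B)))
      (fun k => PiTensorProduct.map (Pi.mulSingle k (Matrix.toLin' ⁅A, B⁆))) (fun k => ?_) (fun k l hkl => ?_)
    · rw [← PiTensorProduct.map_mul, ← PiTensorProduct.map_mul]
      have h1 := Pi.mulSingle_mul (f := fun _ : ι => Module.End ℂ (Fin n → ℂ)) k
        (Matrix.toLin' A) (Matrix.toLin' B)
      have h2 := Pi.mulSingle_mul (f := fun _ : ι => Module.End ℂ (Fin n → ℂ)) k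
        (Matrix.toLin' B) (Matrix.toLin' A)
      have h3 : ∀ M N : gl n, Matrix.toLin' M * Matrix.toLin' N = Matrix.toLin' (M * N) :=
        fun M N => (Matrix.toLin'_mul M N).symm
      rw [h3] at h1 h2
      refine Eq.trans ?_ (congrArg PiTensorProduct.map h1)
      refine Eq.trans (congrArg (_ + ·) (congrArg PiTensorProduct.map h2.symm)) ?_
      refine (PiTensorProduct.map_update_add _ k _ _).symm.trans ?_
      rw [← map_add, Ring.lie_def, sub_add_cancel]
      rfl
    · rw [← PiTensorProduct.map_mul, ← PiTensorProduct.map_mul]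
      congr 1
      exact Pi.mulSingle_commute hkl _ _

noncomputable instance (n : ℕ) (ι : Type) [Fintype ι] [DecidableEq ι] :
    LieRingModule (gl n) (Tensor n ι) :=
  LieRingModule.compLieHom (Tensor n ι) (tensorRep n ι)

instance (n : ℕ) (ι : Type) [Fintype ι] [DecidableEq ι] : LieModule ℂ (gl n) (Tensor n ι) :=
  LieModule.compLieHom (Tensor n ι) (tensorRep n ι)

/-! ### Partitions, tableaux and Schur modules -/

/-- The permutations of the boxes of `μ` that preserve every row. -/
def rowGroup (μ : YoungDiagram) : Finset (Equiv.Perm μ.cells) :=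
  {p | ∀ c, (p c : ℕ × ℕ).1 = (c : ℕ × ℕ).1}

/-- The permutations of the boxes of `μ` that preserve every column. -/
def colGroup (μ : YoungDiagram) : Finset (Equiv.Perm μ.cells) :=
  {q | ∀ c, (q c : ℕ × ℕ).2 = (c : ℕ × ℕ).2}

/-- The right action of permutations on tensors by permuting the places:
`(⊗ₖ vₖ) · σ = ⊗ₖ v_{σ(k)}`. -/
noncomputable def permute (n : ℕ) {ι : Type} (σ : Equiv.Perm ι) : Tensor n ι →ₗ[ℂ] Tensor n ι :=
  (PiTensorProduct.reindex ℂ (fun _ : ι => (Fin n → ℂ)) σ.symm).toLinearMap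

theorem permute_tprod (n : ℕ) {ι : Type} (σ : Equiv.Perm ι) (v : ι → Fin n → ℂ) :
    permute n σ (PiTensorProduct.tprod ℂ v) = PiTensorProduct.tprod ℂ (fun k => v (σ k)) :=
  PiTensorProduct.reindex_tprod σ.symm v

theorem permute_tensorRep (n : ℕ) {ι : Type} [Fintype ι] [DecidableEq ι] (σ : Equiv.Perm ι)
    (A : gl n) (t : Tensor n ι) :
    permute n σ (tensorRep n ι A t) = tensorRep n ι A (permute n σ t) := by
  suffices h : permute n σ ∘ₗ tensorRep n ι A = tensorRep n ι A ∘ₗ permute n σ from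
    LinearMap.congr_fun h t
  refine PiTensorProduct.ext (MultilinearMap.ext fun v => ?_)
  change permute n σ ((∑ k, PiTensorProduct.map (Pi.mulSingle k (Matrix.toLin' A)))
      (PiTensorProduct.tprod ℂ v)) = (∑ k, PiTensorProduct.map (Pi.mulSingle k (Matrix.toLin' A)))
      (permute n σ (PiTensorProduct.tprod ℂ v))
  rw [permute_tprod, LinearMap.sum_apply, LinearMap.sum_apply, map_sum]
  simp only [PiTensorProduct.map_tprod, permute_tprod]
  refine (Equiv.sum_comp σ _).symm.trans (Finset.sum_congr rfl fun k _ => ?_)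
  congr 1
  funext l
  by_cases h : l = k
  · subst h; simp
  · rw [Pi.mulSingle_eq_of_ne h, Pi.mulSingle_eq_of_ne (σ.injective.ne h)]

/-- Right multiplication by the Young symmetrizer `∑_q ∑_p sgn(q) q p`, with `q` in the column group
and `p` in the row group, on the tensor power of `ℂⁿ` with factors indexed by the boxes of `μ`. -/
noncomputable def youngSymmetrizer (n : ℕ) (μ : YoungDiagram) :
    Tensor n μ.cells →ₗ[ℂ] Tensor n μ.cells :=
  ∑ q ∈ colGroup μ, ∑ p ∈ rowGroup μ, ((Equiv.Perm.sign q : ℤ) : ℂ) • permute n (q * p)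

/-- The Schur module `E^μ` of `𝔤𝔩ₙ(ℂ)`: the image of the Young symmetrizer. Indexing the tensor
factors by the boxes of `μ` avoids the choice of a numbering of the boxes. -/
noncomputable def schurModule (n : ℕ) (μ : YoungDiagram) :
    LieSubmodule ℂ (gl n) (Tensor n μ.cells) where
  toSubmodule := LinearMap.range (youngSymmetrizer n μ)
  lie_mem := by
    rintro A _ ⟨t, rfl⟩
    refine ⟨tensorRep n μ.cells A t, ?_⟩
    change _ = tensorRep n μ.cells A _
    simp only [youngSymmetrizer, LinearMap.sum_apply, LinearMap.smul_apply, map_sum, map_smul,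
      permute_tensorRep]

/-- The standard tableaux of shape `μ`: the numberings of the boxes by `0, …, |μ| - 1` that strictly
increase along the rows and down the columns. -/
def StandardTableau (μ : YoungDiagram) : Type :=
  {T : μ.cells ≃ Fin μ.card //
    (∀ c d : μ.cells, (c : ℕ × ℕ).1 = (d : ℕ × ℕ).1 → (c : ℕ × ℕ).2 < (d : ℕ × ℕ).2 → T c < T d) ∧
    (∀ c d : μ.cells, (c : ℕ × ℕ).2 = (d : ℕ × ℕ).2 → (c : ℕ × ℕ).1 < (d : ℕ × ℕ).1 → T c < T d)}

/-- The number `f^μ` of standard tableaux of shape `μ`. -/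
noncomputable def numStandard (μ : YoungDiagram) : ℕ := Nat.card (StandardTableau μ)

/-- The direct sum of the modules `(E^μ)^{⊕ f^μ}` over the partitions `μ` of `n` that satisfy `P`. -/
abbrev schurSum (n : ℕ) (P : YoungDiagram → Prop) : Type :=
  ⨁ μ : {μ : YoungDiagram // μ.card = n ∧ P μ}, ⨁ _ : Fin (numStandard μ.1), schurModule n μ.1

end AlphaDet

/-! The map `e_{i₁} ⊗ ⋯ ⊗ e_{iₙ} ↦ x_{i₁ 1} ⋯ x_{iₙ n}` embeds the tensor power into the polynomials
as a `𝔤𝔩ₙ`-module. The `α`-determinant is the image of `a · (e₁ ⊗ ⋯ ⊗ eₙ)`, where `a = ∑_σ α^{n -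
ν(σ)} σ` is `alphaElt n α`. The two actions on tensors commute and `e₁ ⊗ ⋯ ⊗ eₙ` generates all
tensors, so the cyclic module is the image of `a` on the tensor power (`mem_cyclicModule`).

The group algebra is the direct sum of the right ideals generated by the Young symmetrizers `c_T` of
all standard tableaux with `n` boxes. Independence follows from a total order on tableaux, and
exhaustion from the dimension count `∑ (f^μ)² = n!`. Hence the tensor power is the direct sum of the
images of the `c_T`, each a copy of the Schur module of the shape of `T`. Since `a` is central, it
remains to show that `a` kills `c_T` for the excluded shapes and is injective on `c_T ℂ[𝔖ₙ]` for the
others (`range_schurSumHom`).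

For `α = ±1/k`: a permutation `σ` fixes `k^{ν(σ)}` colourings `f : [n] → [k]`, so `kⁿ a` is the sum
over all `f` of the (signed) sums over their stabilizers. If the first column (resp. row) has more
than `k` boxes, two of them share a colour and every term kills `c_T`, possibly after `a` is moved
past the row sum. Otherwise the row (resp. column) function of `T` is one of the colourings. The
stabilizer sums are positive for the Hermitian form on the group algebra, so an element killed by
`a` is killed by each of them, in particular by the row (resp. column) sum of `T`.

For the remaining `α`, `a = ∏ (1 + α J_m)` with the Jucys–Murphy elements `J_m`, `0 ≤ m < n`, whose
eigenvalues are integers in `[-m, m]`; so `a` is a unit. -/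

namespace AlphaDet

open Equiv MonoidAlgebra

/-! ### Signed sums over stabilizers of functions in the group algebra -/

section StabSum

variable {ι : Type*} [Fintype ι] [DecidableEq ι] {β γ : Type*} [DecidableEq β] [DecidableEq γ]

/-- The group algebra of the symmetric group of `ι`. -/
abbrev PermAlg (ι : Type*) : Type _ := MonoidAlgebra ℂ (Perm ι)

/-- The sum of `χ(σ) σ` over all permutations `σ` with `f ∘ σ = f`. -/
noncomputable def stabSum (χ : Perm ι →* ℤˣ) (f : ι → β) : PermAlg ι :=
  ∑ σ : Perm ι with ∀ i, f (σ i) = f i, ((χ σ : ℤ) : ℂ) • single σ 1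

theorem units_mul_self (u : ℤˣ) : ((u : ℤ) : ℂ) * ((u : ℤ) : ℂ) = 1 := by
  rcases Int.units_eq_one_or u with rfl | rfl <;> simp

theorem single_mul_stabSum (χ : Perm ι →* ℤˣ) (f : ι → β) (τ : Perm ι)
    (hτ : ∀ i, f (τ i) = f i) :
    single τ 1 * stabSum χ f = ((χ τ : ℤ) : ℂ) • stabSum χ f := by
  rw [stabSum, Finset.mul_sum, Finset.smul_sum]
  refine Finset.sum_equiv (Equiv.mulLeft τ) (fun σ => ?_) (fun σ _ => ?_)
  · simp [hτ]
  · simp only [coe_mulLeft, map_mul, mul_smul_comm, single_mul_single, mul_one, smul_smul,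
      Units.val_mul, Int.cast_mul, ← mul_assoc, units_mul_self, one_mul]

theorem stabSum_mul_single (χ : Perm ι →* ℤˣ) (f : ι → β) (τ : Perm ι)
    (hτ : ∀ i, f (τ i) = f i) :
    stabSum χ f * single τ 1 = ((χ τ : ℤ) : ℂ) • stabSum χ f := by
  rw [stabSum, Finset.sum_mul, Finset.smul_sum]
  refine Finset.sum_equiv (Equiv.mulRight τ) (fun σ => ?_) (fun σ _ => ?_)
  · simp only [Finset.mem_filter, Finset.mem_univ, true_and, coe_mulRight, Perm.coe_mul,
      Function.comp_apply]
    refine ⟨fun h i => (h _).trans (hτ i), fun h i => ?_⟩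
    have h1 := h (τ.symm i)
    have h2 := hτ (τ.symm i)
    rw [apply_symm_apply] at h1 h2
    rw [h1, h2]
  · simp only [coe_mulRight, map_mul, smul_mul_assoc, single_mul_single, mul_one, smul_smul,
      Units.val_mul, Int.cast_mul]
    congr 1
    rw [mul_comm, mul_assoc, units_mul_self, mul_one]

/-- The number of permutations that stabilize `f`. -/
def stabCard (f : ι → β) : ℕ := Finset.card {σ : Perm ι | ∀ i, f (σ i) = f i}

theorem stabCard_ne_zero (f : ι → β) : (stabCard f : ℂ) ≠ 0 := by
  rw [Nat.cast_ne_zero, stabCard]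
  exact Finset.card_ne_zero_of_mem (a := 1) (by simp)

theorem stabSum_mul_self (χ : Perm ι →* ℤˣ) (f : ι → β) :
    stabSum χ f * stabSum χ f = (stabCard f : ℂ) • stabSum χ f := by
  conv_lhs => enter [1]; rw [stabSum]
  rw [Finset.sum_mul, stabCard, Nat.cast_smul_eq_nsmul, ← Finset.sum_const]
  refine Finset.sum_congr rfl fun σ hσ => ?_
  rw [smul_mul_assoc, single_mul_stabSum χ f σ (by simpa using hσ), smul_smul, units_mul_self,
    one_smul]

/-- Lets a colouring with values in `Fin k` be exchanged for the row or column function with values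
in `ℕ`. -/
theorem stabSum_comp_of_injective (χ : Perm ι →* ℤˣ) (f : ι → β) {g : β → γ}
    (hg : Function.Injective g) : stabSum χ (g ∘ f) = stabSum χ f := by
  simp [stabSum, hg.eq_iff]

/-- The stabilizer of `f ∘ τ` is the `τ`-conjugate of that of `f`. This compares symmetrizers of
tableaux of one shape. -/
theorem stabSum_conj {χ : Perm ι →* ℤˣ} (f : ι → β) (τ : Perm ι) :
    single τ 1 * stabSum χ (f ∘ τ) = stabSum χ f * single τ 1 := by
  rw [stabSum, stabSum, Finset.mul_sum, Finset.sum_mul]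
  refine Finset.sum_equiv (MulAut.conj τ).toEquiv (fun σ => ?_) (fun σ _ => ?_)
  · simp only [Finset.mem_filter, Finset.mem_univ, true_and, Function.comp_apply,
      MulEquiv.toEquiv_eq_coe, EquivLike.coe_coe, MulAut.conj_apply, Perm.coe_mul]
    refine ⟨fun h i => ?_, fun h i => ?_⟩
    · have := h (τ⁻¹ i)
      simpa using this
    · have := h (τ i)
      simpa using this
  · simp only [MulEquiv.toEquiv_eq_coe, EquivLike.coe_coe, MulAut.conj_apply, map_mul, map_inv,
      mul_inv_cancel_comm, mul_smul_comm, smul_mul_assoc, single_mul_single, mul_one,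
      inv_mul_cancel_right]

/-- Symmetrizing and antisymmetrizing over a common transposition gives zero. -/
theorem stabSum_mul_eq_zero {χ ψ : Perm ι →* ℤˣ} {f : ι → β} {g : ι → γ} {i j : ι}
    (hf : f i = f j) (hg : g i = g j) (h : χ (swap i j) = -ψ (swap i j)) :
    stabSum χ f * stabSum ψ g = 0 := by
  have hf' : ∀ k, f (swap i j k) = f k := fun k => by
    rw [swap_apply_def]; split_ifs with h1 h2 <;> simp [*]
  have hg' : ∀ k, g (swap i j k) = g k := fun k => by
    rw [swap_apply_def]; split_ifs with h1 h2 <;> simp [*]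
  have h1 : stabSum χ f * single (swap i j) 1 * stabSum ψ g
      = ((χ (swap i j) : ℤ) : ℂ) • (stabSum χ f * stabSum ψ g) := by
    rw [stabSum_mul_single χ f _ hf', smul_mul_assoc]
  rw [mul_assoc, single_mul_stabSum ψ g _ hg', mul_smul_comm, h] at h1
  have h2 : ((ψ (swap i j) : ℤ) : ℂ) ≠ 0 := by simp
  have h3 : (2 * ((ψ (swap i j) : ℤ) : ℂ)) • (stabSum χ f * stabSum ψ g) = 0 := by
    rw [two_mul, add_smul]
    nth_rw 1 [h1]
    simp
  exact (smul_eq_zero.mp h3).resolve_left (mul_ne_zero two_ne_zero h2)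

theorem stabSum_one_mul_sign {f : ι → β} {g : ι → γ} {i j : ι} (hij : i ≠ j)
    (hf : f i = f j) (hg : g i = g j) : stabSum 1 f * stabSum Perm.sign g = 0 :=
  stabSum_mul_eq_zero hf hg (by simp [Perm.sign_swap hij])

theorem stabSum_sign_mul_one {f : ι → β} {g : ι → γ} {i j : ι} (hij : i ≠ j)
    (hf : f i = f j) (hg : g i = g j) : stabSum Perm.sign f * stabSum 1 g = 0 :=
  stabSum_mul_eq_zero hf hg (by simp [Perm.sign_swap hij])

/-! ### Positivity of stabilizer sums for the Hermitian form -/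

/-- The standard Hermitian form on the group algebra. -/
noncomputable def herm (x y : PermAlg ι) : ℂ := ∑ g, (starRingEnd ℂ) (x.coeff g) * y.coeff g

theorem herm_self (x : PermAlg ι) : herm x x = ((∑ g, Complex.normSq (x.coeff g) : ℝ) : ℂ) := by
  simp [herm, Complex.normSq_eq_conj_mul_self]

theorem herm_self_re_nonneg (x : PermAlg ι) : 0 ≤ (herm x x).re := by
  rw [herm_self, Complex.ofReal_re]
  exact Finset.sum_nonneg fun g _ => Complex.normSq_nonneg _

theorem eq_zero_of_herm_self_re (x : PermAlg ι) (h : (herm x x).re = 0) : x = 0 := by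
  rw [herm_self, Complex.ofReal_re,
    Finset.sum_eq_zero_iff_of_nonneg fun g _ => Complex.normSq_nonneg _] at h
  ext g
  simpa using h g

theorem herm_zero_right (x : PermAlg ι) : herm x 0 = 0 := by simp [herm]

theorem herm_sum_right {κ : Type*} (s : Finset κ) (x : PermAlg ι) (y : κ → PermAlg ι) :
    herm x (∑ k ∈ s, y k) = ∑ k ∈ s, herm x (y k) := by
  simp only [herm, coeff_sum, Finset.sum_apply, Finsupp.coe_finsetSum, Finset.mul_sum]
  exact Finset.sum_comm

theorem herm_sum_left {κ : Type*} (s : Finset κ) (x : PermAlg ι) (y : κ → PermAlg ι) :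
    herm (∑ k ∈ s, y k) x = ∑ k ∈ s, herm (y k) x := by
  simp only [herm, coeff_sum, Finset.sum_apply, Finsupp.coe_finsetSum, map_sum, Finset.sum_mul]
  exact Finset.sum_comm

theorem herm_smul_right (c : ℂ) (x y : PermAlg ι) : herm x (c • y) = c * herm x y := by
  simp only [herm, coeff_smul, Finsupp.smul_apply, smul_eq_mul, Finset.mul_sum]
  exact Finset.sum_congr rfl fun g _ => by ring

theorem herm_smul_left (c : ℂ) (x y : PermAlg ι) :
    herm (c • x) y = (starRingEnd ℂ) c * herm x y := by
  simp only [herm, coeff_smul, Finsupp.smul_apply, smul_eq_mul, Finset.mul_sum, map_mul]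
  exact Finset.sum_congr rfl fun g _ => by ring

theorem coeff_single_one_mul' {ι : Type*} (τ : Perm ι) (x : PermAlg ι) (g : Perm ι) :
    (single τ 1 * x).coeff g = x.coeff (τ⁻¹ * g) := by
  rw [coeff_single_mul_eq_mul_coeff (τ⁻¹ * g) (by
    intro m _; rw [eq_inv_mul_iff_mul_eq]), one_mul]

theorem herm_single_mul (τ : Perm ι) (x y : PermAlg ι) :
    herm (single τ 1 * x) y = herm x (single τ⁻¹ 1 * y) := by
  simp only [herm, coeff_single_one_mul', inv_inv]
  exact Fintype.sum_equiv (Equiv.mulLeft τ⁻¹) _ _ fun g => by simp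

/-- Left multiplication by `σ` is unitary, inversion preserves the stabilizer, and `χ(σ⁻¹) = χ(σ)`
is real, so stabilizer sums are self-adjoint. -/
theorem herm_stabSum_mul (χ : Perm ι →* ℤˣ) (f : ι → β) (x y : PermAlg ι) :
    herm (stabSum χ f * x) y = herm x (stabSum χ f * y) := by
  simp only [stabSum, Finset.sum_mul, herm_sum_left, herm_sum_right, smul_mul_assoc,
    herm_smul_left, herm_smul_right, herm_single_mul]
  refine Finset.sum_equiv (Equiv.inv _) (fun σ => ?_) (fun σ _ => ?_)
  · simp only [Finset.mem_filter, Finset.mem_univ, true_and, Equiv.inv_apply]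
    refine ⟨fun h i => ?_, fun h i => ?_⟩
    · simpa using (h (σ⁻¹ i)).symm
    · simpa using (h (σ i)).symm
  · simp

theorem herm_stabSum_mul_self (χ : Perm ι →* ℤˣ) (f : ι → β) (x : PermAlg ι) :
    herm (stabSum χ f * x) (stabSum χ f * x) = stabCard f * herm x (stabSum χ f * x) := by
  rw [herm_stabSum_mul, ← mul_assoc, stabSum_mul_self, smul_mul_assoc, herm_smul_right]

/-- A stabilizer sum is self-adjoint and proportional to an idempotent with a positive factor, hence
a positive operator. -/
theorem herm_stabSum_mul_re (χ : Perm ι →* ℤˣ) (f : ι → β) (x : PermAlg ι) :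
    (herm (stabSum χ f * x) (stabSum χ f * x)).re
      = stabCard f * (herm x (stabSum χ f * x)).re := by
  rw [herm_stabSum_mul_self, ← Complex.ofReal_natCast, Complex.re_ofReal_mul]

theorem stabCard_pos (f : ι → β) : (0 : ℝ) < stabCard f := by
  have := stabCard_ne_zero f
  rw [Nat.cast_ne_zero] at this
  exact_mod_cast Nat.pos_of_ne_zero this

theorem stabSum_mul_eq_zero_of_herm (χ : Perm ι →* ℤˣ) (f : ι → β) (x : PermAlg ι)
    (h : (herm x (stabSum χ f * x)).re = 0) : stabSum χ f * x = 0 := by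
  apply eq_zero_of_herm_self_re
  rw [herm_stabSum_mul_re, h, mul_zero]

/-- A sum of the positive elements `stabSum χ f` annihilates `x` only if all its terms do. -/
theorem stabSum_mul_eq_zero_of_sum {κ : Type*} (s : Finset κ) (χ : Perm ι →* ℤˣ)
    (f : κ → ι → β) (x : PermAlg ι) (h : (∑ k ∈ s, stabSum χ (f k)) * x = 0) :
    ∀ k ∈ s, stabSum χ (f k) * x = 0 := by
  have h1 : ∑ k ∈ s, (herm x (stabSum χ (f k) * x)).re = 0 := by
    rw [← Complex.re_sum, ← herm_sum_right, ← Finset.sum_mul, h, herm_zero_right, Complex.zero_re]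
  rw [Finset.sum_eq_zero_iff_of_nonneg] at h1
  · exact fun k hk => stabSum_mul_eq_zero_of_herm χ (f k) x (h1 k hk)
  · intro k _
    have h2 := herm_self_re_nonneg (stabSum χ (f k) * x)
    rw [herm_stabSum_mul_re] at h2
    exact nonneg_of_mul_nonneg_right h2 (stabCard_pos _)

/-- With `A = stabSum χ f` and `B = stabSum ψ g`, the form of `A x` with `B A x` equals that of `x`
with `A B A x`, which vanishes; positivity of `B` then gives `B A x = 0`. -/
theorem stabSum_mul_mul_eq_zero (χ ψ : Perm ι →* ℤˣ) (f : ι → β) (g : ι → γ) (x : PermAlg ι)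
    (h : stabSum χ f * (stabSum ψ g * (stabSum χ f * x)) = 0) :
    stabSum ψ g * (stabSum χ f * x) = 0 := by
  apply stabSum_mul_eq_zero_of_herm
  rw [herm_stabSum_mul, h, herm_zero_right, Complex.zero_re]

/-- The product of two stabilizer sums does not vanish if the two stabilizers intersect
trivially. -/
theorem stabSum_mul_stabSum_ne_zero (χ ψ : Perm ι →* ℤˣ) (f : ι → β) (g : ι → γ)
    (h : ∀ i j, f i = f j → g i = g j → i = j) : stabSum χ f * stabSum ψ g ≠ 0 := by
  intro h0
  -- A pair `σ`, `τ` contributes to the coefficient of `1` only if `τ = σ⁻¹`; then `σ` lies in both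
  -- stabilizers, so `σ = 1`.
  have h1 : (stabSum χ f * stabSum ψ g).coeff 1 = 1 := by
    rw [stabSum, Finset.sum_mul, coeff_sum, Finsupp.coe_finsetSum, Finset.sum_apply,
      Finset.sum_eq_single 1]
    · rw [smul_mul_assoc, coeff_smul, Finsupp.smul_apply, coeff_single_one_mul', stabSum, coeff_sum,
        Finsupp.coe_finsetSum, Finset.sum_apply, Finset.sum_eq_single 1]
      · simp [coeff_single]
      · intro σ _ hσ
        simp [coeff_single, hσ]
      · simp
    · intro σ hσ hσ1
      rw [smul_mul_assoc, coeff_smul, Finsupp.smul_apply, coeff_single_one_mul', stabSum, coeff_sum,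
        Finsupp.coe_finsetSum, Finset.sum_apply, Finset.sum_eq_zero, smul_zero]
      intro τ hτ
      simp only [Finset.mem_filter, Finset.mem_univ, true_and] at hσ hτ
      have hne : τ ≠ σ⁻¹ := by
        rintro rfl
        apply hσ1
        ext i
        refine h _ _ (hσ i) ?_
        have := hτ (σ i)
        simpa using this.symm
      rw [coeff_smul, coeff_single, mul_one, Finsupp.smul_apply, Finsupp.single_eq_of_ne' hne, smul_zero]
    · simp
  rw [h0] at h1
  simp at h1

end StabSum

end AlphaDet

namespace AlphaDet

open Equiv MonoidAlgebra

/-! ### Numbers of cycles -/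

section Cycles

variable {ι : Type*} [Fintype ι] [DecidableEq ι]

/-- The functions invariant under `σ` are the functions on the cycles of `σ`. -/
def invariantFunEquiv (σ : Perm ι) (κ : Type*) :
    {f : ι → κ // ∀ i, f (σ i) = f i} ≃ (Quotient (Perm.SameCycle.setoid σ) → κ) where
  toFun f := Quotient.lift f.1 (by
    rintro a b ⟨z, rfl⟩
    have h : ∀ (m : ℕ) (i : ι), f.1 ((σ ^ m) i) = f.1 i := by
      intro m
      induction m with
      | zero => simp
      | succ m ih => intro i; rw [pow_succ, Perm.mul_apply, ih, f.2]
    cases z with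
    | ofNat m => exact (h m a).symm
    | negSucc m =>
      have h1 := h (m + 1) ((σ ^ (m + 1))⁻¹ a)
      rw [← Perm.mul_apply, mul_inv_cancel, Perm.one_apply] at h1
      rw [zpow_negSucc]
      exact h1)
  invFun g := ⟨fun i => g (Quotient.mk _ i), fun i => congrArg g (Quotient.sound
    ((Perm.sameCycle_apply_left).mpr (Perm.SameCycle.refl σ i)))⟩
  left_inv f := rfl
  right_inv g := by
    funext q
    induction q using Quotient.inductionOn
    rfl

/-- Each orbit is either the support of one nontrivial cycle factor or a single fixed point, and
these are exactly the parts of the partition. -/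
theorem card_sameCycle_quotient (σ : Perm ι) :
    Nat.card (Quotient (Perm.SameCycle.setoid σ)) = σ.partition.parts.card := by
  classical
  have hne : ∀ c : σ.cycleFactorsFinset, (c : Perm ι).support.Nonempty := fun c => by
    obtain ⟨c, hc⟩ := c
    exact Perm.IsCycle.nonempty_support (Perm.mem_cycleFactorsFinset_iff.mp hc).1
  let x : σ.cycleFactorsFinset → ι := fun c => (hne c).choose
  have hx : ∀ c : σ.cycleFactorsFinset, x c ∈ (c : Perm ι).support := fun c => (hne c).choose_spec
  have hxc : ∀ c : σ.cycleFactorsFinset, (c : Perm ι) = σ.cycleOf (x c) :=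
    fun c => Perm.cycle_is_cycleOf (hx c) c.2
  have hxs : ∀ c, x c ∈ σ.support := fun c => Perm.mem_cycleFactorsFinset_support_le c.2 (hx c)
  let ψ : σ.cycleFactorsFinset ⊕ {i // i ∉ σ.support} → Quotient (Perm.SameCycle.setoid σ) :=
    Sum.elim (fun c => Quotient.mk _ (x c)) (fun i => Quotient.mk _ i.1)
  have hfix : ∀ i j, i ∉ σ.support → σ.SameCycle i j → i = j := by
    rintro i j hi ⟨z, rfl⟩
    exact (Perm.zpow_apply_eq_self_of_apply_eq_self (Perm.notMem_support.mp hi) z).symm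
  have hψ : Function.Bijective ψ := by
    constructor
    · rintro (c | i) (d | j) h
      · have h1 : σ.SameCycle (x c) (x d) := Quotient.exact h
        have : (c : Perm ι) = d := by
          rw [hxc c, hxc d, h1.cycleOf_eq]
        exact congrArg _ (Subtype.ext this)
      · have h1 : σ.SameCycle (x c) j := Quotient.exact h
        have := hfix _ _ j.2 h1.symm
        exact absurd (this ▸ hxs c) j.2
      · have h1 : σ.SameCycle i (x d) := Quotient.exact h
        have := hfix _ _ i.2 h1
        exact absurd (this ▸ hxs d) i.2
      · have h1 : σ.SameCycle i j := Quotient.exact h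
        exact congrArg _ (Subtype.ext (hfix _ _ i.2 h1))
    · intro q
      induction q using Quotient.inductionOn with | _ i => ?_
      by_cases hi : i ∈ σ.support
      · let c : σ.cycleFactorsFinset :=
          ⟨σ.cycleOf i, Perm.cycleOf_mem_cycleFactorsFinset_iff.mpr hi⟩
        refine ⟨Sum.inl c, Quotient.sound ?_⟩
        have h1 : x c ∈ (σ.cycleOf i).support := hx c
        exact ((Perm.mem_support_cycleOf_iff.mp h1).1).symm
      · exact ⟨Sum.inr ⟨i, hi⟩, rfl⟩
  rw [← Nat.card_eq_of_bijective ψ hψ, Nat.card_sum, Perm.parts_partition, Multiset.card_add,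
    Multiset.card_replicate, Perm.cycleType_def, Multiset.card_map, Nat.card_eq_fintype_card,
    Nat.card_eq_fintype_card, Fintype.card_coe, Fintype.card_subtype_compl, Fintype.card_coe]
  rfl

variable {n : ℕ}

/-- An invariant colouring is a free choice of colour on each cycle. This turns powers of `k` into
sums over colourings; the case `k = 2` also yields facts about the number of cycles itself. -/
theorem card_invariantFun (σ : Perm (Fin n)) (k : ℕ) :
    Fintype.card {f : Fin n → Fin k // ∀ i, f (σ i) = f i} = k ^ numCycles σ := by
  rw [← Nat.card_eq_fintype_card, Nat.card_congr (invariantFunEquiv σ (Fin k)), Nat.card_fun,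
    card_sameCycle_quotient, Nat.card_eq_fintype_card, Fintype.card_fin, numCycles]

theorem numCycles_le (σ : Perm (Fin n)) : numCycles σ ≤ n := by
  have h := card_invariantFun σ 2
  have h2 : Fintype.card {f : Fin n → Fin 2 // ∀ i, f (σ i) = f i} ≤ 2 ^ n := by
    refine (Fintype.card_subtype_le _).trans ?_
    simp
  rw [h] at h2
  exact (Nat.pow_le_pow_iff_right (by norm_num)).mp h2

theorem numCycles_conj (σ τ : Perm (Fin n)) : numCycles (τ * σ * τ⁻¹) = numCycles σ := by
  rw [numCycles, numCycles, ← Perm.partition_eq_of_isConj.mp (isConj_iff.mpr ⟨τ, rfl⟩)]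

theorem neg_one_pow_sub_numCycles (σ : Perm (Fin n)) :
    (-1 : ℂ) ^ (n - numCycles σ) = ((Perm.sign σ : ℤ) : ℂ) := by
  have h1 := numCycles_le σ
  have h2 : σ.support.card ≤ n := by simpa using σ.support.card_le_univ
  have h3 : numCycles σ = σ.cycleType.card + (n - σ.support.card) := by
    simp [numCycles, Perm.parts_partition]
  rw [Perm.sign_of_cycleType, Perm.sum_cycleType]
  push_cast
  -- The exponent in the cycle type formula for the sign exceeds `n - ν(σ)` by twice the number of
  -- nontrivial cycles.
  rw [show σ.support.card + σ.cycleType.card = (n - numCycles σ) + 2 * σ.cycleType.card by omega,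
    pow_add, pow_mul]
  simp

/-- The transposition merges the fixed point `m` into the cycle of `i`. In terms of 2-colourings: an
invariant colouring of `σ` is one of the product together with a free colour at `m`, so `2^ν`
doubles. -/
theorem numCycles_mul_swap (σ : Perm (Fin n)) {i m : Fin n} (hm : σ m = m) (him : i ≠ m) :
    numCycles (σ * swap i m) + 1 = numCycles σ := by
  have hmi : ∀ j, σ j = m → j = m := fun j hj => σ.injective (hj.trans hm.symm)
  have key : ∀ f : Fin n → Fin 2, (∀ j, f ((σ * swap i m) j) = f j) ↔
      (∀ j, f (σ j) = f j) ∧ f m = f i := by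
    intro f
    constructor
    · intro h
      have hi := h i
      have hm' := h m
      simp only [Perm.mul_apply, swap_apply_left, swap_apply_right, hm] at hi hm'
      refine ⟨fun j => ?_, hi⟩
      by_cases h1 : j = i
      · subst h1; rw [hm', hi]
      · by_cases h2 : j = m
        · subst h2; rw [hm]
        · have := h j
          rwa [Perm.mul_apply, swap_apply_of_ne_of_ne h1 h2] at this
    · rintro ⟨h, hi⟩ j
      rw [Perm.mul_apply, h, swap_apply_def]
      split_ifs with h1 h2 <;> simp [*]
  let e : {f : Fin n → Fin 2 // ∀ j, f (σ j) = f j} ≃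
      {f : Fin n → Fin 2 // ∀ j, f ((σ * swap i m) j) = f j} × Fin 2 :=
    { toFun := fun f => (⟨Function.update f.1 m (f.1 i), by
        rw [key]
        refine ⟨fun j => ?_, by simp [him]⟩
        by_cases h : j = m
        · subst h; rw [hm]
        · rw [Function.update_of_ne h, Function.update_of_ne (fun h' => h (hmi j h')), f.2]⟩,
          f.1 m)
      invFun := fun g => ⟨Function.update g.1.1 m g.2, by
        have hg := ((key _).mp g.1.2).1
        intro j
        by_cases h : j = m
        · subst h; rw [hm]
        · rw [Function.update_of_ne h, Function.update_of_ne (fun h' => h (hmi j h')), hg]⟩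
      left_inv := fun f => by simp
      right_inv := fun g => by
        have hg := ((key _).mp g.1.2).2
        refine Prod.ext (Subtype.ext ?_) ?_
        · simp [him, ← hg]
        · simp }
  have h := Fintype.card_congr e
  rw [Fintype.card_prod, card_invariantFun, card_invariantFun, Fintype.card_fin, ← pow_succ] at h
  exact (Nat.pow_right_injective (le_refl 2) h).symm

end Cycles

/-! ### Jucys–Murphy elements -/

section JucysMurphy

variable {n : ℕ}

/-- The element `∑_σ α^{n - ν(σ)} σ` of the group algebra. -/
noncomputable def alphaElt (n : ℕ) (α : ℂ) : PermAlg (Fin n) :=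
  ∑ σ : Perm (Fin n), α ^ (n - numCycles σ) • single σ 1

/-- The coefficient `α^{n - ν(σ)}` depends only on the conjugacy class of `σ`. -/
theorem single_mul_alphaElt (α : ℂ) (τ : Perm (Fin n)) :
    single τ 1 * alphaElt n α = alphaElt n α * single τ 1 := by
  rw [alphaElt, Finset.mul_sum, Finset.sum_mul]
  refine Fintype.sum_equiv (MulAut.conj τ).toEquiv _ _ fun σ => ?_
  simp only [MulEquiv.toEquiv_eq_coe, EquivLike.coe_coe, MulAut.conj_apply, numCycles_conj,
    mul_smul_comm, smul_mul_assoc, single_mul_single, mul_one, inv_mul_cancel_right]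

theorem alphaElt_central (α : ℂ) (x : PermAlg (Fin n)) :
    x * alphaElt n α = alphaElt n α * x := by
  induction x using MonoidAlgebra.induction_linear with
  | zero => simp
  | add x y hx hy => rw [add_mul, mul_add, hx, hy]
  | single σ c =>
    have : (single σ c : PermAlg (Fin n)) = c • single σ 1 := by simp
    rw [this, smul_mul_assoc, mul_smul_comm, single_mul_alphaElt]

/-- The Jucys–Murphy element `∑_{i < k} (i k)`. -/
noncomputable def jucysMurphy (k : Fin n) : PermAlg (Fin n) :=
  ∑ i : Fin n with i < k, single (swap i k) 1

theorem single_mul_jucysMurphy (k : Fin n) (σ : Perm (Fin n)) (hk : σ k = k)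
    (hσ : ∀ i, σ i < k ↔ i < k) :
    single σ 1 * jucysMurphy k = jucysMurphy k * single σ 1 := by
  rw [jucysMurphy, Finset.mul_sum, Finset.sum_mul]
  refine Finset.sum_equiv σ (fun i => by simp [hσ]) fun i _ => ?_
  rw [single_mul_single, single_mul_single, mul_swap_eq_swap_mul, hk]

theorem jucysMurphy_commute {k l : Fin n} (hkl : k < l) :
    jucysMurphy k * jucysMurphy l = jucysMurphy l * jucysMurphy k := by
  rw [jucysMurphy, Finset.sum_mul, Finset.mul_sum]
  refine Finset.sum_congr rfl fun i hi => ?_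
  have hi : i < k := by simpa using hi
  refine single_mul_jucysMurphy l _ (swap_apply_of_ne_of_ne (hi.trans hkl).ne' hkl.ne') fun j => ?_
  rw [swap_apply_def]
  split_ifs with h1 h2
  · simp [h1, hkl, hi.trans hkl]
  · simp [h2, hkl, hi.trans hkl]
  · rfl

/-- Conjugation by `s = (k l)` turns each `(i k)` with `i < k` into `(i l)`; the only term of the
next Jucys–Murphy element not obtained so is `s` itself, and `s² = 1`. -/
theorem jucysMurphy_mul_swap {k l : Fin n} (hkl : (l : ℕ) = k + 1) :
    jucysMurphy k * single (swap k l) 1 = single (swap k l) 1 * jucysMurphy l - 1 := by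
  have hlt : k < l := Fin.lt_def.mpr (by omega)
  have h : (Finset.univ.filter fun i : Fin n => i < l)
      = insert k (Finset.univ.filter fun i : Fin n => i < k) := by
    ext i
    simp only [Finset.mem_filter, Finset.mem_univ, true_and, Finset.mem_insert, Fin.lt_def,
      Fin.ext_iff]
    omega
  rw [eq_sub_iff_add_eq]
  conv_rhs => rw [jucysMurphy, h, Finset.sum_insert (by simp)]
  rw [mul_add, single_mul_single, swap_mul_self, one_mul, add_comm, jucysMurphy, Finset.mul_sum,
    Finset.sum_mul]
  refine congrArg₂ (· + ·) rfl (Finset.sum_congr rfl fun i hi => ?_)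
  have hi : i < k := by simpa using hi
  rw [single_mul_single, single_mul_single, mul_swap_eq_swap_mul (swap k l) i l,
    swap_apply_of_ne_of_ne hi.ne (hi.trans hlt).ne, swap_apply_right]

/-- The eigenvalues of left multiplication by the Jucys–Murphy element with index `k` (counted from
`0`) are integers of absolute value at most `k`. Induction on `k`: a common eigenvector of two
neighbouring elements, together with its image under the transposition `s`, ties the new eigenvalue
to an old one. -/
theorem eq_zero_of_jucysMurphy_mul (k : ℕ) (hk : k < n) (z : ℂ)
    (hz : ∀ j : ℤ, |j| ≤ k → z ≠ j) (v : PermAlg (Fin n))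
    (hv : jucysMurphy ⟨k, hk⟩ * v = z • v) : v = 0 := by
  induction k generalizing z v with
  | zero =>
    have h0 : jucysMurphy (⟨0, hk⟩ : Fin n) = 0 := by
      rw [jucysMurphy, Finset.filter_false_of_mem, Finset.sum_empty]
      simp [Fin.lt_def]
    rw [h0, zero_mul] at hv
    refine (smul_eq_zero.mp hv.symm).resolve_left ?_
    simpa using hz 0 (by simp)
  | succ k ih =>
    have hk' : k < n := by omega
    set J := jucysMurphy (⟨k, hk'⟩ : Fin n) with hJ
    set J' := jucysMurphy (⟨k + 1, hk⟩ : Fin n) with hJ'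
    have hc : J * J' = J' * J := jucysMurphy_commute (by simp [Fin.lt_def])
    set s : PermAlg (Fin n) := single (swap ⟨k, hk'⟩ ⟨k + 1, hk⟩) 1 with hs
    have hss : s * s = 1 := by rw [hs, single_mul_single, swap_mul_self, one_mul]; rfl
    have hJs : J * s = s * J' - 1 := jucysMurphy_mul_swap rfl
    -- `J` preserves the `z`-eigenspace of `J'`, so it has an eigenvector `w` there, whose
    -- eigenvalue is an integer by induction.
    let W : Submodule ℂ (PermAlg (Fin n)) :=
      LinearMap.ker (LinearMap.mulLeft ℂ J' - z • LinearMap.id)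
    have hW : ∀ w, w ∈ W ↔ J' * w = z • w := fun w => by
      simp [W, LinearMap.mem_ker, sub_eq_zero]
    by_contra hv0
    have : Nontrivial W := ⟨⟨v, (hW v).mpr hv⟩, 0, fun h => hv0 (congrArg Subtype.val h)⟩
    have : Module.Finite ℂ (PermAlg (Fin n)) :=
      Module.Finite.of_basis (MonoidAlgebra.basis (Perm (Fin n)) ℂ)
    let T : Module.End ℂ W := (LinearMap.mulLeft ℂ J).restrict (p := W) (q := W) (by
      intro w hw
      rw [hW] at hw ⊢
      rw [LinearMap.mulLeft_apply, ← mul_assoc, ← hc, mul_assoc, hw, mul_smul_comm])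
    obtain ⟨c, hcT⟩ := Module.End.exists_eigenvalue T
    obtain ⟨⟨w, hwW⟩, hw⟩ := hcT.exists_hasEigenvector
    have hw0 : w ≠ 0 := fun h => hw.2 (Subtype.ext h)
    have hJw : J * w = c • w := congrArg Subtype.val hw.apply_eq_smul
    rw [hW] at hwW
    have hJsw : J * (s * w) = z • (s * w) - w := by
      rw [← mul_assoc, hJs, sub_mul, one_mul, mul_assoc, hwW, mul_smul_comm]
    have hc' : ∃ j : ℤ, |j| ≤ k ∧ c = j := by
      by_contra! h
      exact hw0 (ih hk' c h w hJw)
    obtain ⟨j, hj, rfl⟩ := hc'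
    have hz' : ∀ i : ℤ, |i| ≤ k → z ≠ i := fun i hi => hz i (by push_cast; omega)
    -- This combination is a `z`-eigenvector of `J`, and `z` is excluded as an eigenvalue of `J` by
    -- induction. Applying `s` and eliminating `s * w` leaves `(j - z)² = 1`, that is, `z = j ± 1`.
    have h1 : ((j : ℂ) - z) • (s * w) + w = 0 := by
      refine ih hk' z hz' _ ?_
      rw [mul_add, mul_smul_comm, hJsw, hJw]
      module
    have h2 : ((j : ℂ) - z) • w + s * w = 0 := by
      have := congrArg (s * ·) h1
      simpa [mul_add, mul_smul_comm, ← mul_assoc, hss] using this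
    have h3 : (1 - ((j : ℂ) - z) ^ 2) • w = 0 := by
      have e : (1 - ((j : ℂ) - z) ^ 2) • w
          = (((j : ℂ) - z) • (s * w) + w) - ((j : ℂ) - z) • (((j : ℂ) - z) • w + s * w) := by
        module
      rw [e, h1, h2]
      simp
    have h4 := (smul_eq_zero.mp h3).resolve_right hw0
    have h5 : (z - (j - 1 : ℤ)) * (z - (j + 1 : ℤ)) = 0 := by
      push_cast
      linear_combination -h4
    rcases mul_eq_zero.mp h5 with h | h
    · exact hz (j - 1) (by push_cast; rw [abs_le] at hj ⊢; omega) (sub_eq_zero.mp h)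
    · exact hz (j + 1) (by push_cast; rw [abs_le] at hj ⊢; omega) (sub_eq_zero.mp h)

theorem isUnit_of_mul_left_injective (x : PermAlg (Fin n)) (h : ∀ v, x * v = 0 → v = 0) :
    IsUnit x := by
  have : Module.Finite ℂ (PermAlg (Fin n)) :=
    Module.Finite.of_basis (MonoidAlgebra.basis (Perm (Fin n)) ℂ)
  have hinj : Function.Injective (LinearMap.mulLeft ℂ x) := by
    rw [← LinearMap.ker_eq_bot, LinearMap.ker_eq_bot']
    exact h
  obtain ⟨y, hy⟩ := LinearMap.injective_iff_surjective.mp hinj 1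
  have hy : x * y = 1 := hy
  have hyx : y * x = 1 := by
    have : x * (y * x - 1) = 0 := by rw [mul_sub, ← mul_assoc, hy, one_mul, mul_one, sub_self]
    exact sub_eq_zero.mp (h _ this)
  exact ⟨⟨x, y, hy, hyx⟩, rfl⟩

/-- The part of `alphaElt` supported on the permutations of the first `m` letters. -/
noncomputable def alphaPartial (n : ℕ) (α : ℂ) (m : ℕ) : PermAlg (Fin n) :=
  ∑ σ : Perm (Fin n) with ∀ i : Fin n, m ≤ i → σ i = i, α ^ (n - numCycles σ) • single σ 1

/-- A permutation of the first `m + 1` letters is uniquely `σ (i m)` with `σ` fixing `m` and `i ≤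
m`. The factor is trivial for `i = m`; otherwise it lowers the number of cycles by one and costs a
factor `α`. -/
theorem alphaPartial_succ (α : ℂ) (m : Fin n) :
    alphaPartial n α (m + 1) = alphaPartial n α m * (1 + α • jucysMurphy m) := by
  have h1 : (1 + α • jucysMurphy m : PermAlg (Fin n))
      = ∑ i : Fin n with i ≤ m, (if i = m then 1 else α) • single (swap i m) 1 := by
    have h : (Finset.univ.filter fun i : Fin n => i ≤ m)
        = insert m (Finset.univ.filter fun i : Fin n => i < m) := by
      ext i
      simp [le_iff_eq_or_lt]
    rw [h, Finset.sum_insert (by simp), jucysMurphy, Finset.smul_sum]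
    congr 1
    · simp [MonoidAlgebra.one_def]; rfl
    · refine Finset.sum_congr rfl fun i hi => ?_
      rw [if_neg (by simpa using (show i < m by simpa using hi).ne)]
  rw [h1, alphaPartial, alphaPartial, Finset.sum_mul_sum, ← Finset.sum_product']
  symm
  -- The index `i` is recovered from `τ = σ (i m)` as the preimage of `m`.
  refine Finset.sum_nbij' (fun p => p.1 * swap p.2 m) (fun τ => (τ * swap (τ.symm m) m, τ.symm m))
    ?_ ?_ ?_ ?_ ?_
  · rintro ⟨σ, i⟩ h
    simp only [Finset.mem_product, Finset.mem_filter, Finset.mem_univ, true_and] at h ⊢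
    intro j hj
    rw [Perm.mul_apply, swap_apply_of_ne_of_ne]
    · exact h.1 j (by omega)
    · rintro rfl; have := Fin.le_def.mp h.2; omega
    · rintro rfl; omega
  · intro τ h
    simp only [Finset.mem_product, Finset.mem_filter, Finset.mem_univ, true_and] at h ⊢
    constructor
    · intro j hj
      rcases hj.eq_or_lt with hj | hj
      · have : j = m := Fin.ext hj.symm
        subst this
        simp
      · have hjm : j ≠ m := by rintro rfl; omega
        rw [Perm.mul_apply, swap_apply_of_ne_of_ne _ hjm, h j hj]
        intro hj'
        rw [eq_symm_apply, h j hj] at hj'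
        exact hjm hj'
    · by_contra! hlt
      have h2 := h (τ.symm m) (Fin.lt_def.mp hlt)
      rw [apply_symm_apply] at h2
      exact absurd hlt (h2 ▸ lt_irrefl _)
  · rintro ⟨σ, i⟩ h
    simp only [Finset.mem_product, Finset.mem_filter, Finset.mem_univ, true_and] at h
    have hσ : σ.symm m = m := by rw [symm_apply_eq, h.1 m le_rfl]
    have hi : (σ * swap i m).symm m = i := by
      rw [symm_apply_eq, Perm.mul_apply, swap_apply_left, h.1 m le_rfl]
    rw [hi]
    simp [mul_assoc]
  · intro τ _
    simp [mul_assoc]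
  · rintro ⟨σ, i⟩ h
    simp only [Finset.mem_product, Finset.mem_filter, Finset.mem_univ, true_and] at h
    simp only [mul_smul_comm, smul_mul_assoc, smul_smul, single_mul_single, mul_one]
    congr 1
    split_ifs with him
    · subst him; rw [swap_self, show σ * Equiv.refl (Fin n) = σ from rfl, one_mul]
    · have h2 := numCycles_mul_swap σ (h.1 m le_rfl) him
      have h3 := numCycles_le σ
      rw [show n - numCycles (σ * swap i m) = (n - numCycles σ) + 1 by omega, pow_succ, mul_comm]

/-- The factor `1 + α J_m` fails to be injective only if `-1/α` is an eigenvalue of `J_m`, a nonzero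
integer of absolute value at most `m ≤ n - 1`; then `α` is an excluded value. -/
theorem isUnit_alphaElt (α : ℂ)
    (hα : ∀ k : ℕ, 1 ≤ k → k < n → α ≠ 1 / (k : ℂ) ∧ α ≠ -(1 / (k : ℂ))) :
    IsUnit (alphaElt n α) := by
  have h : ∀ m ≤ n, IsUnit (alphaPartial n α m) := by
    intro m
    induction m with
    | zero =>
      intro _
      have : alphaPartial n α 0 = 1 := by
        rw [alphaPartial, Finset.sum_eq_single 1]
        · have h1 : numCycles (1 : Perm (Fin n)) = n := by
            simp [numCycles, Perm.parts_partition]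
          rw [h1, Nat.sub_self, pow_zero, one_smul]
          rfl
        · intro σ hσ hσ1
          exact absurd (Perm.ext (by simpa using hσ)) hσ1
        · simp
      rw [this]
      exact isUnit_one
    | succ m ih =>
      intro hm
      have h1 := alphaPartial_succ α (⟨m, hm⟩ : Fin n)
      rw [show m + 1 = ((⟨m, hm⟩ : Fin n) : ℕ) + 1 from rfl, h1]
      refine (ih (by omega)).mul (isUnit_of_mul_left_injective _ fun v hv => ?_)
      rw [add_mul, one_mul, smul_mul_assoc] at hv
      by_cases hα0 : α = 0
      · simpa [hα0] using hv
      · refine eq_zero_of_jucysMurphy_mul m hm (-α⁻¹) ?_ v ?_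
        · intro j hj hj'
          have hα1 : α * j = -1 := by rw [← hj']; field_simp
          have hj0 : j ≠ 0 := by rintro rfl; simp at hα1
          rw [Int.abs_eq_natAbs] at hj
          have hk := hα j.natAbs (by omega) (by omega)
          have hjC : (j : ℂ) ≠ 0 := by exact_mod_cast hj0
          have hαj : α = -1 / j := by rw [eq_div_iff hjC, hα1]
          have hnc : ((j.natAbs : ℕ) : ℂ) = ((|j| : ℤ) : ℂ) := by
            rw [Int.abs_eq_natAbs]; simp
          rw [hnc] at hk
          rcases abs_choice j with h | h
          · rw [h] at hk
            exact hk.2 (by rw [hαj]; ring)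
          · rw [h] at hk
            refine hk.1 ?_
            rw [hαj]
            push_cast
            rw [div_neg, neg_div]
        · have h2 : α • (jucysMurphy (⟨m, hm⟩ : Fin n) * v) = -v := by
            rw [eq_neg_iff_add_eq_zero, add_comm]; exact hv
          rw [neg_smul, ← smul_neg, ← h2, smul_smul, inv_mul_cancel₀ hα0, one_smul]
  have h2 := h n le_rfl
  have : alphaPartial n α n = alphaElt n α := by
    rw [alphaPartial, alphaElt, Finset.filter_true_of_mem]
    intro σ _ i hi
    omega
  rwa [this] at h2

end JucysMurphy

end AlphaDet

namespace AlphaDet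

/-! ### Young's lattice and the sum of the squares of the numbers of standard tableaux -/

section YoungLattice

/-- The box `c` may be added to `μ`. -/
def Addable (μ : YoungDiagram) (c : ℕ × ℕ) : Prop := c ∉ μ ∧ ∀ d, d < c → d ∈ μ

/-- The box `c` may be removed from `μ`. -/
def Removable (μ : YoungDiagram) (c : ℕ × ℕ) : Prop := c ∈ μ ∧ ∀ d, c < d → d ∉ μ

open Classical in
/-- The diagram `μ` with the addable box `c` added. -/
noncomputable def addBox (μ : YoungDiagram) (c : ℕ × ℕ) : YoungDiagram :=
  if h : Addable μ c then
    { cells := insert c μ.cells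
      isLowerSet := by
        intro a b hba ha
        simp only [Finset.coe_insert, Set.mem_insert_iff, Finset.mem_coe, YoungDiagram.mem_cells]
          at ha ⊢
        rcases ha with rfl | ha
        · exact hba.eq_or_lt.imp id (h.2 b)
        · exact Or.inr (μ.isLowerSet hba ha) }
  else μ

open Classical in
/-- The diagram `μ` with the removable box `c` removed. -/
noncomputable def removeBox (μ : YoungDiagram) (c : ℕ × ℕ) : YoungDiagram :=
  if h : Removable μ c then
    { cells := μ.cells.erase c
      isLowerSet := by
        intro a b hba ha
        simp only [Finset.coe_erase, Set.mem_sdiff, Finset.mem_coe, YoungDiagram.mem_cells,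
          Set.mem_singleton_iff] at ha ⊢
        refine ⟨μ.isLowerSet hba ha.1, ?_⟩
        rintro rfl
        exact h.2 a (lt_of_le_of_ne hba (Ne.symm ha.2)) ha.1 }
  else μ

theorem mem_addBox {μ : YoungDiagram} {c : ℕ × ℕ} (h : Addable μ c) (d : ℕ × ℕ) :
    d ∈ addBox μ c ↔ d = c ∨ d ∈ μ := by
  rw [addBox, dif_pos h, ← YoungDiagram.mem_cells, Finset.mem_insert, YoungDiagram.mem_cells]

theorem mem_removeBox {μ : YoungDiagram} {c : ℕ × ℕ} (h : Removable μ c) (d : ℕ × ℕ) :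
    d ∈ removeBox μ c ↔ d ≠ c ∧ d ∈ μ := by
  rw [removeBox, dif_pos h, ← YoungDiagram.mem_cells, Finset.mem_erase, YoungDiagram.mem_cells]

theorem card_addBox {μ : YoungDiagram} {c : ℕ × ℕ} (h : Addable μ c) :
    (addBox μ c).card = μ.card + 1 := by
  rw [addBox, dif_pos h]
  exact Finset.card_insert_of_notMem h.1

theorem card_removeBox {μ : YoungDiagram} {c : ℕ × ℕ} (h : Removable μ c) :
    (removeBox μ c).card + 1 = μ.card := by
  rw [removeBox, dif_pos h]
  exact Finset.card_erase_add_one h.1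

theorem diagram_ext {μ ν : YoungDiagram} (h : ∀ d, d ∈ μ ↔ d ∈ ν) : μ = ν :=
  SetLike.ext h

theorem removable_addBox_self {μ : YoungDiagram} {c : ℕ × ℕ} (h : Addable μ c) :
    Removable (addBox μ c) c := by
  refine ⟨(mem_addBox h c).mpr (Or.inl rfl), fun d hd hd' => ?_⟩
  rcases (mem_addBox h d).mp hd' with rfl | hd'
  · exact lt_irrefl _ hd
  · exact h.1 (μ.isLowerSet hd.le hd')

theorem addable_removeBox_self {μ : YoungDiagram} {c : ℕ × ℕ} (h : Removable μ c) :
    Addable (removeBox μ c) c := by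
  refine ⟨fun h' => ((mem_removeBox h c).mp h').1 rfl, fun d hd => ?_⟩
  exact (mem_removeBox h d).mpr ⟨hd.ne, μ.isLowerSet hd.le h.1⟩

theorem removeBox_addBox_self {μ : YoungDiagram} {c : ℕ × ℕ} (h : Addable μ c) :
    removeBox (addBox μ c) c = μ := by
  refine diagram_ext fun d => ?_
  rw [mem_removeBox (removable_addBox_self h), mem_addBox h]
  refine ⟨fun hd => hd.2.resolve_left hd.1, fun hd => ⟨?_, Or.inr hd⟩⟩
  rintro rfl
  exact h.1 hd

theorem addBox_removeBox_self {μ : YoungDiagram} {c : ℕ × ℕ} (h : Removable μ c) :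
    addBox (removeBox μ c) c = μ := by
  refine diagram_ext fun d => ?_
  rw [mem_addBox (addable_removeBox_self h), mem_removeBox h]
  refine ⟨?_, fun hd => (em (d = c)).imp id fun hdc => ⟨hdc, hd⟩⟩
  rintro (rfl | hd)
  · exact h.1
  · exact hd.2

theorem removable_addBox_iff {μ : YoungDiagram} {x y : ℕ × ℕ} (hx : Addable μ x) (hxy : y ≠ x) :
    Removable (addBox μ x) y ↔ Removable μ y ∧ ¬ y < x := by
  simp only [Removable, mem_addBox hx, hxy, false_or]
  constructor
  · rintro ⟨h1, h2⟩
    exact ⟨⟨h1, fun d hd hd' => h2 d hd (Or.inr hd')⟩, fun h => h2 x h (Or.inl rfl)⟩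
  · rintro ⟨⟨h1, h2⟩, h3⟩
    refine ⟨h1, fun d hd => ?_⟩
    rintro (rfl | hd')
    · exact h3 hd
    · exact h2 d hd hd'

theorem addable_removeBox_iff {μ : YoungDiagram} {x y : ℕ × ℕ} (hy : Removable μ y)
    (hxy : x ≠ y) : Addable (removeBox μ y) x ↔ Addable μ x ∧ ¬ y < x := by
  simp only [Addable, mem_removeBox hy, not_and, ne_eq, hxy, not_false_eq_true, forall_const]
  constructor
  · rintro ⟨h1, h2⟩
    exact ⟨⟨h1, fun d hd => (h2 d hd).2⟩, fun h => (h2 y h).1 rfl⟩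
  · rintro ⟨⟨h1, h2⟩, h3⟩
    refine ⟨h1, fun d hd => ⟨?_, h2 d hd⟩⟩
    rintro rfl
    exact h3 hd

theorem removeBox_addBox_comm {μ : YoungDiagram} {x y : ℕ × ℕ} (hx : Addable μ x)
    (hy : Removable μ y) (hxy : ¬ y < x) :
    removeBox (addBox μ x) y = addBox (removeBox μ y) x := by
  have hne : y ≠ x := by rintro rfl; exact hx.1 hy.1
  refine diagram_ext fun d => ?_
  rw [mem_removeBox ((removable_addBox_iff hx hne).mpr ⟨hy, hxy⟩), mem_addBox hx,
    mem_addBox ((addable_removeBox_iff hy hne.symm).mpr ⟨hx, hxy⟩), mem_removeBox hy]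
  constructor
  · rintro ⟨h1, h2 | h2⟩
    · exact Or.inl h2
    · exact Or.inr ⟨h1, h2⟩
  · rintro (rfl | ⟨h1, h2⟩)
    · exact ⟨hne.symm, Or.inl rfl⟩
    · exact ⟨h1, Or.inr h2⟩

open Classical in
/-- The removable boxes of `μ`. -/
noncomputable def removables (μ : YoungDiagram) : Finset (ℕ × ℕ) := {c ∈ μ.cells | Removable μ c}

theorem mem_removables {μ : YoungDiagram} {c : ℕ × ℕ} : c ∈ removables μ ↔ Removable μ c := by
  classical
  rw [removables, Finset.mem_filter, and_iff_right_iff_imp]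
  exact fun h => h.1

theorem removable_iff {μ : YoungDiagram} {i j : ℕ} :
    Removable μ (i, j) ↔ j + 1 = μ.rowLen i ∧ μ.rowLen (i + 1) < μ.rowLen i := by
  constructor
  · rintro ⟨h1, h2⟩
    have h3 := h2 (i, j + 1) (by simp [Prod.lt_iff])
    have h4 := h2 (i + 1, j) (by simp [Prod.lt_iff])
    rw [YoungDiagram.mem_iff_lt_rowLen] at h1 h3 h4
    omega
  · rintro ⟨h1, h2⟩
    refine ⟨by rw [YoungDiagram.mem_iff_lt_rowLen]; omega, ?_⟩
    rintro ⟨i', j'⟩ hd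
    rw [YoungDiagram.mem_iff_lt_rowLen]
    rw [Prod.lt_iff] at hd
    simp only at hd
    rcases hd with ⟨h3, h4⟩ | ⟨h3, h4⟩
    · have := μ.rowLen_anti (i + 1) i' h3
      omega
    · have := μ.rowLen_anti i i' h3
      omega

theorem addable_iff {μ : YoungDiagram} {i j : ℕ} :
    Addable μ (i, j) ↔ j = μ.rowLen i ∧ (i = 0 ∨ μ.rowLen i < μ.rowLen (i - 1)) := by
  constructor
  · rintro ⟨h1, h2⟩
    rw [YoungDiagram.mem_iff_lt_rowLen] at h1
    have h3 : j ≤ μ.rowLen i := by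
      rcases Nat.eq_zero_or_pos j with h | h
      · omega
      · have := h2 (i, j - 1) (by simp [Prod.lt_iff]; omega)
        rw [YoungDiagram.mem_iff_lt_rowLen] at this
        omega
    refine ⟨by omega, ?_⟩
    rcases Nat.eq_zero_or_pos i with h | h
    · exact Or.inl h
    · have := h2 (i - 1, j) (by simp [Prod.lt_iff]; omega)
      rw [YoungDiagram.mem_iff_lt_rowLen] at this
      omega
  · rintro ⟨rfl, h⟩
    refine ⟨by rw [YoungDiagram.mem_iff_lt_rowLen]; omega, ?_⟩
    rintro ⟨i', j'⟩ hd
    rw [YoungDiagram.mem_iff_lt_rowLen]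
    rw [Prod.lt_iff] at hd
    simp only at hd
    rcases hd with ⟨h3, h4⟩ | ⟨h3, h4⟩
    · have := μ.rowLen_anti i' (i - 1) (by omega)
      omega
    · have := μ.rowLen_anti i' i h3
      omega

/-- The addable boxes of `μ`: one in the first row, and one in the row below each removable box. -/
noncomputable def addables (μ : YoungDiagram) : Finset (ℕ × ℕ) :=
  insert (0, μ.rowLen 0) ((removables μ).image fun c => (c.1 + 1, μ.rowLen (c.1 + 1)))

theorem mem_addables {μ : YoungDiagram} {c : ℕ × ℕ} : c ∈ addables μ ↔ Addable μ c := by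
  obtain ⟨i, j⟩ := c
  rw [addable_iff, addables, Finset.mem_insert, Finset.mem_image]
  constructor
  · rintro (h | ⟨⟨i', j'⟩, h, h'⟩)
    · simp only [Prod.mk.injEq] at h
      obtain ⟨rfl, rfl⟩ := h
      simp
    · rw [mem_removables, removable_iff] at h
      simp only [Prod.mk.injEq] at h'
      obtain ⟨rfl, rfl⟩ := h'
      exact ⟨rfl, Or.inr (by simpa using h.2)⟩
  · rintro ⟨rfl, h⟩
    rcases i with _ | i
    · exact Or.inl rfl
    · have h2 : μ.rowLen (i + 1) < μ.rowLen i := by simpa using h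
      refine Or.inr ⟨(i, μ.rowLen i - 1), ?_, rfl⟩
      rw [mem_removables, removable_iff]
      omega

theorem card_addables (μ : YoungDiagram) : (addables μ).card = (removables μ).card + 1 := by
  rw [addables, Finset.card_insert_of_notMem (by simp), Finset.card_image_of_injOn]
  rintro ⟨i, j⟩ h ⟨i', j'⟩ h' hh
  rw [Finset.mem_coe, mem_removables, removable_iff] at h h'
  simp only [Prod.mk.injEq, Nat.add_right_cancel_iff] at hh
  obtain ⟨rfl, -⟩ := hh
  rw [Prod.mk.injEq]
  omega

/-- The commutation relation of the operators that add and remove a box. -/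
theorem sum_add_remove (φ : YoungDiagram → ℕ) (μ : YoungDiagram) :
    ∑ x ∈ addables μ, ∑ y ∈ removables (addBox μ x), φ (removeBox (addBox μ x) y)
      = ∑ y ∈ removables μ, ∑ x ∈ addables (removeBox μ y), φ (addBox (removeBox μ y) x)
        + φ μ := by
  classical
  have h1 : ∀ x ∈ addables μ, ∑ y ∈ removables (addBox μ x), φ (removeBox (addBox μ x) y)
      = φ μ + ∑ y ∈ removables μ with ¬ y < x, φ (removeBox (addBox μ x) y) := by
    intro x hx
    rw [mem_addables] at hx
    -- Adding `x` makes `x` removable and blocks exactly the removable boxes below `x` in the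
    -- product order.
    have : removables (addBox μ x) = insert x {y ∈ removables μ | ¬ y < x} := by
      ext y
      rw [Finset.mem_insert, Finset.mem_filter, mem_removables, mem_removables]
      by_cases hy : y = x
      · subst hy
        simp [removable_addBox_self hx]
      · simp [hy, removable_addBox_iff hx hy]
    rw [this, Finset.sum_insert, removeBox_addBox_self hx]
    rw [Finset.mem_filter, mem_removables]
    exact fun h => hx.1 h.1.1
  have h2 : ∀ y ∈ removables μ, ∑ x ∈ addables (removeBox μ y), φ (addBox (removeBox μ y) x)
      = φ μ + ∑ x ∈ addables μ with ¬ y < x, φ (removeBox (addBox μ x) y) := by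
    intro y hy
    rw [mem_removables] at hy
    have : addables (removeBox μ y) = insert y {x ∈ addables μ | ¬ y < x} := by
      ext x
      rw [Finset.mem_insert, Finset.mem_filter, mem_addables, mem_addables]
      by_cases hx : x = y
      · subst hx
        simp [addable_removeBox_self hy]
      · simp [hx, addable_removeBox_iff hy hx]
    rw [this, Finset.sum_insert, addBox_removeBox_self hy]
    · congr 1
      refine Finset.sum_congr rfl fun x hx => ?_
      rw [Finset.mem_filter, mem_addables] at hx
      rw [removeBox_addBox_comm hx.1 hy hx.2]
    · rw [Finset.mem_filter, mem_addables]
      exact fun h => h.1.1 hy.1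
  -- The mixed terms range over the same pairs on both sides. The diagonal terms `φ μ` occur once
  -- per addable, resp. removable, box, and there is one more addable box.
  rw [Finset.sum_congr rfl h1, Finset.sum_congr rfl h2, Finset.sum_add_distrib,
    Finset.sum_add_distrib, Finset.sum_const, Finset.sum_const, card_addables]
  simp only [Finset.sum_filter]
  rw [Finset.sum_comm]
  simp only [smul_eq_mul]
  ring

/-! ### Counting standard tableaux -/

/-- Standard tableaux as functions on `ℕ × ℕ` that vanish off the diagram, with entries
`1, …, |μ|`. -/
structure IsStandardFun (μ : YoungDiagram) (t : ℕ × ℕ → ℕ) : Prop where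
  zero : ∀ c, c ∉ μ → t c = 0
  pos : ∀ c, c ∈ μ → 0 < t c
  le : ∀ c, c ∈ μ → t c ≤ μ.card
  inj : ∀ c d, c ∈ μ → d ∈ μ → t c = t d → c = d
  mono : ∀ c d, c ∈ μ → d ∈ μ → c < d → t c < t d

theorem StandardTableau.lt_of_lt {μ : YoungDiagram} (T : StandardTableau μ) {c d : μ.cells}
    (h : (c : ℕ × ℕ) < d) : T.1 c < T.1 d := by
  obtain ⟨⟨i, j⟩, hc⟩ := c
  obtain ⟨⟨i', j'⟩, hd⟩ := d
  have hij : i ≤ i' ∧ j ≤ j' := h.le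
  have hm : (i, j') ∈ μ.cells := μ.isLowerSet (show (i, j') ≤ (i', j') from ⟨hij.1, le_rfl⟩) hd
  rcases hij.1.eq_or_lt with h1 | h1
  · subst h1
    refine T.2.1 _ _ rfl (lt_of_le_of_ne hij.2 ?_)
    rintro rfl
    exact lt_irrefl _ h
  · refine lt_of_le_of_lt ?_ (T.2.2 ⟨(i, j'), hm⟩ _ rfl h1)
    rcases hij.2.eq_or_lt with h2 | h2
    · subst h2; exact le_rfl
    · exact (T.2.1 ⟨(i, j), hc⟩ ⟨(i, j'), hm⟩ rfl h2).le

open Classical in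
/-- Standard tableaux and standard functions correspond to each other. -/
theorem nonempty_equiv_isStandardFun (μ : YoungDiagram) :
    Nonempty (StandardTableau μ ≃ {t : ℕ × ℕ → ℕ // IsStandardFun μ t}) := by
  let F : StandardTableau μ → {t : ℕ × ℕ → ℕ // IsStandardFun μ t} := fun T =>
    ⟨fun c => if h : c ∈ μ.cells then T.1 ⟨c, h⟩ + 1 else 0,
      { zero := fun c hc => dif_neg hc
        pos := fun c hc => by rw [dif_pos (show c ∈ μ.cells from hc)]; omega
        le := fun c hc => by
          rw [dif_pos (show c ∈ μ.cells from hc)]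
          exact (T.1 ⟨c, hc⟩).2
        inj := fun c d hc hd h => by
          rw [dif_pos (show c ∈ μ.cells from hc), dif_pos (show d ∈ μ.cells from hd)] at h
          have := T.1.injective (Fin.ext (Nat.succ_injective h))
          exact congrArg Subtype.val this
        mono := fun c d hc hd h => by
          rw [dif_pos (show c ∈ μ.cells from hc), dif_pos (show d ∈ μ.cells from hd)]
          have := T.lt_of_lt (c := ⟨c, hc⟩) (d := ⟨d, hd⟩) h
          exact Nat.succ_lt_succ this }⟩
  have hF : ∀ T (c : μ.cells), (F T).1 c = T.1 c + 1 := fun T c => dif_pos c.2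
  refine ⟨Equiv.ofBijective F ⟨fun T T' h => ?_, fun t => ?_⟩⟩
  · refine Subtype.ext (Equiv.ext fun c => Fin.ext ?_)
    have h1 := hF T c
    rw [h, hF T' c] at h1
    omega
  · let g : μ.cells → Fin μ.card := fun c => ⟨t.1 c - 1, by
      have h1 := t.2.pos c c.2
      have h2 := t.2.le c c.2
      omega⟩
    have hg : ∀ c : μ.cells, t.1 c = (g c : ℕ) + 1 := fun c =>
      (Nat.sub_add_cancel (t.2.pos c c.2)).symm
    have hgb : Function.Bijective g := by
      rw [Fintype.bijective_iff_injective_and_card]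
      refine ⟨fun c d h => Subtype.ext (t.2.inj c d c.2 d.2 ?_), by simp [YoungDiagram.card]⟩
      rw [hg, hg, h]
    have hm : ∀ c d : μ.cells, (c : ℕ × ℕ) < d → g c < g d := fun c d h => by
      have h1 := t.2.mono c d c.2 d.2 h
      rw [hg, hg] at h1
      exact Fin.lt_def.mpr (by omega)
    refine ⟨⟨Equiv.ofBijective g hgb, fun c d h1 h2 => hm c d ?_, fun c d h1 h2 => hm c d ?_⟩, ?_⟩
    · exact Prod.lt_iff.mpr (Or.inr ⟨h1.le, h2⟩)
    · exact Prod.lt_iff.mpr (Or.inl ⟨h2, h1.le⟩)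
    · refine Subtype.ext (funext fun c => ?_)
      by_cases hc : c ∈ μ.cells
      · refine (hF _ ⟨c, hc⟩).trans ?_
        exact (hg ⟨c, hc⟩).symm
      · refine (dif_neg hc).trans ?_
        exact (t.2.zero c hc).symm

instance (μ : YoungDiagram) : Finite (StandardTableau μ) := by
  unfold StandardTableau
  infer_instance

instance (μ : YoungDiagram) : Finite {t : ℕ × ℕ → ℕ // IsStandardFun μ t} :=
  Finite.of_equiv _ (nonempty_equiv_isStandardFun μ).some

theorem numStandard_eq (μ : YoungDiagram) :
    numStandard μ = Nat.card {t : ℕ × ℕ → ℕ // IsStandardFun μ t} :=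
  Nat.card_congr (nonempty_equiv_isStandardFun μ).some

theorem numStandard_bot : numStandard ⊥ = 1 := by
  rw [numStandard_eq, Nat.card_eq_one_iff_unique]
  refine ⟨⟨fun t t' => Subtype.ext (funext fun c => ?_)⟩, ⟨⟨fun _ => 0, ?_⟩⟩⟩
  · rw [t.2.zero c (by simp), t'.2.zero c (by simp)]
  · constructor <;> simp

theorem isStandardFun_update {μ : YoungDiagram} {y : ℕ × ℕ} (hy : Removable μ y)
    {t : ℕ × ℕ → ℕ} (ht : IsStandardFun (removeBox μ y) t) :
    IsStandardFun μ (Function.update t y μ.card) := by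
  have hcard := card_removeBox hy
  have hm : ∀ c, c ∈ μ → c ≠ y → c ∈ removeBox μ y := fun c hc hcy =>
    (mem_removeBox hy c).mpr ⟨hcy, hc⟩
  have hlt : ∀ c, c ∈ μ → c ≠ y → t c < μ.card := fun c hc hcy => by
    have := ht.le c (hm c hc hcy); omega
  constructor
  · intro c hc
    have hcy : c ≠ y := by rintro rfl; exact hc hy.1
    rw [Function.update_of_ne hcy]
    exact ht.zero c fun h => hc ((mem_removeBox hy c).mp h).2
  · intro c hc
    by_cases hcy : c = y
    · subst hcy; rw [Function.update_self]; omega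
    · rw [Function.update_of_ne hcy]; exact ht.pos c (hm c hc hcy)
  · intro c hc
    by_cases hcy : c = y
    · subst hcy; rw [Function.update_self]
    · rw [Function.update_of_ne hcy]; exact (hlt c hc hcy).le
  · intro c d hc hd h
    by_cases hcy : c = y
    · by_cases hdy : d = y
      · rw [hcy, hdy]
      · rw [hcy, Function.update_self, Function.update_of_ne hdy] at h
        exact absurd h (hlt d hd hdy).ne'
    · by_cases hdy : d = y
      · rw [hdy, Function.update_self, Function.update_of_ne hcy] at h
        exact absurd h (hlt c hc hcy).ne
      · rw [Function.update_of_ne hcy, Function.update_of_ne hdy] at h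
        exact ht.inj c d (hm c hc hcy) (hm d hd hdy) h
  · intro c d hc hd h
    have hcy : c ≠ y := by rintro rfl; exact hy.2 d h hd
    rw [Function.update_of_ne hcy]
    by_cases hdy : d = y
    · rw [hdy, Function.update_self]; exact hlt c hc hcy
    · rw [Function.update_of_ne hdy]; exact ht.mono c d (hm c hc hcy) (hm d hd hdy) h

theorem IsStandardFun.exists_eq_card {μ : YoungDiagram} {t : ℕ × ℕ → ℕ} (ht : IsStandardFun μ t)
    (hμ : 0 < μ.card) : ∃ y ∈ μ, t y = μ.card := by
  have h : μ.cells.image t = Finset.Icc 1 μ.card := by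
    refine Finset.eq_of_subset_of_card_le ?_ ?_
    · intro k hk
      obtain ⟨c, hc, rfl⟩ := Finset.mem_image.mp hk
      exact Finset.mem_Icc.mpr ⟨ht.pos c hc, ht.le c hc⟩
    · rw [Finset.card_image_of_injOn fun c hc d hd h => ht.inj c d hc hd h]
      simp [YoungDiagram.card]
  have h2 : μ.card ∈ μ.cells.image t := by rw [h, Finset.mem_Icc]; omega
  obtain ⟨y, hy, hy'⟩ := Finset.mem_image.mp h2
  exact ⟨y, hy, hy'⟩

/-- The box of the largest entry is removable, and deleting it leaves a standard tableau. Functions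
on all of `ℕ × ℕ` make the change of shape a mere update at one box. -/
theorem numStandard_eq_sum (μ : YoungDiagram) (hμ : 0 < μ.card) :
    numStandard μ = ∑ y ∈ removables μ, numStandard (removeBox μ y) := by
  let F : (Σ y : removables μ, {t : ℕ × ℕ → ℕ // IsStandardFun (removeBox μ y) t}) →
      {t : ℕ × ℕ → ℕ // IsStandardFun μ t} :=
    fun p => ⟨Function.update p.2.1 p.1.1 μ.card,
      isStandardFun_update (mem_removables.mp p.1.2) p.2.2⟩
  have hF : Function.Bijective F := by
    constructor
    · rintro ⟨⟨y, hy⟩, t, ht⟩ ⟨⟨y', hy'⟩, t', ht'⟩ h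
      have hy := mem_removables.mp hy
      have hy' := mem_removables.mp hy'
      have h : Function.update t y μ.card = Function.update t' y' μ.card := congrArg Subtype.val h
      have hyy : y = y' := by
        have h1 := isStandardFun_update hy' ht'
        refine h1.inj _ _ hy.1 hy'.1 ?_
        rw [Function.update_self, ← h, Function.update_self]
      subst hyy
      have : t = t' := by
        funext c
        by_cases hc : c = y
        · have hn : c ∉ removeBox μ y := fun h => ((mem_removeBox hy c).mp h).1 hc
          rw [ht.zero c hn, ht'.zero c hn]
        · have := congrFun h c
          rwa [Function.update_of_ne hc, Function.update_of_ne hc] at this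
      subst this
      rfl
    · rintro ⟨t, ht⟩
      obtain ⟨y, hyμ, hty⟩ := ht.exists_eq_card hμ
      have hy : Removable μ y := ⟨hyμ, fun d hd hdμ => by
        have h1 := ht.mono y d hyμ hdμ hd
        have h2 := ht.le d hdμ
        omega⟩
      have hcard := card_removeBox hy
      have ht' : IsStandardFun (removeBox μ y) (Function.update t y 0) := by
        have hne : ∀ c, c ∈ removeBox μ y → Function.update t y 0 c = t c := fun c hc =>
          Function.update_of_ne ((mem_removeBox hy c).mp hc).1 _ _
        have hmem : ∀ c, c ∈ removeBox μ y → c ∈ μ := fun c hc => ((mem_removeBox hy c).mp hc).2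
        constructor
        · intro c hc
          by_cases hcy : c = y
          · rw [hcy, Function.update_self]
          · rw [Function.update_of_ne hcy]
            exact ht.zero c fun h => hc ((mem_removeBox hy c).mpr ⟨hcy, h⟩)
        · intro c hc
          rw [hne c hc]
          exact ht.pos c (hmem c hc)
        · intro c hc
          rw [hne c hc]
          have h1 := ht.le c (hmem c hc)
          have h2 : t c ≠ μ.card := fun h =>
            ((mem_removeBox hy c).mp hc).1 (ht.inj c y (hmem c hc) hyμ (h.trans hty.symm))
          omega
        · intro c d hc hd h
          rw [hne c hc, hne d hd] at h
          exact ht.inj c d (hmem c hc) (hmem d hd) h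
        · intro c d hc hd h
          rw [hne c hc, hne d hd]
          exact ht.mono c d (hmem c hc) (hmem d hd) h
      refine ⟨⟨⟨y, mem_removables.mpr hy⟩, _, ht'⟩, Subtype.ext ?_⟩
      change Function.update (Function.update t y 0) y μ.card = t
      rw [Function.update_idem, ← hty, Function.update_eq_self]
  rw [numStandard_eq, ← Nat.card_eq_of_bijective F hF]
  rw [Nat.card_sigma, Finset.univ_eq_attach,
    Finset.sum_attach _ fun y => Nat.card {t : ℕ × ℕ → ℕ // IsStandardFun (removeBox μ y) t}]
  exact Finset.sum_congr rfl fun y _ => (numStandard_eq _).symm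

/-- Induction on the size: expand each `f` by its largest entry, exchange addition and removal by
`sum_add_remove`, apply the hypothesis to the smaller diagrams, and recombine. -/
theorem sum_addables_numStandard (μ : YoungDiagram) :
    ∑ x ∈ addables μ, numStandard (addBox μ x) = (μ.card + 1) * numStandard μ := by
  obtain ⟨m, hm⟩ : ∃ m, μ.card = m := ⟨_, rfl⟩
  induction m generalizing μ with
  | zero =>
    have h : removables μ = ∅ := by
      rw [Finset.eq_empty_iff_forall_notMem]
      intro c hc
      have := (mem_removables.mp hc).1
      rw [← YoungDiagram.mem_cells, Finset.card_eq_zero.mp hm] at this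
      simp at this
    have h1 : ∀ x ∈ addables μ, numStandard (addBox μ x)
        = ∑ y ∈ removables (addBox μ x), numStandard (removeBox (addBox μ x) y) :=
      fun x hx => numStandard_eq_sum _ (by rw [card_addBox (mem_addables.mp hx)]; omega)
    rw [Finset.sum_congr rfl h1, sum_add_remove, h, hm]
    simp
  | succ m ih =>
    have h1 : ∀ x ∈ addables μ, numStandard (addBox μ x)
        = ∑ y ∈ removables (addBox μ x), numStandard (removeBox (addBox μ x) y) :=
      fun x hx => numStandard_eq_sum _ (by rw [card_addBox (mem_addables.mp hx)]; omega)
    have h2 : ∀ y ∈ removables μ,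
        ∑ x ∈ addables (removeBox μ y), numStandard (addBox (removeBox μ y) x)
          = (m + 1) * numStandard (removeBox μ y) := fun y hy => by
      have := card_removeBox (mem_removables.mp hy)
      have h3 : (removeBox μ y).card = m := by omega
      rw [ih _ h3, h3]
    rw [Finset.sum_congr rfl h1, sum_add_remove, Finset.sum_congr rfl h2, ← Finset.mul_sum,
      ← numStandard_eq_sum μ (by omega), hm]
    ring

theorem finite_diagrams (n : ℕ) : {μ : YoungDiagram | μ.card = n}.Finite := by
  refine Set.Finite.of_finite_image (f := YoungDiagram.cells)
    ((Finset.range n ×ˢ Finset.range n).powerset.finite_toSet.subset ?_) ?_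
  · rintro _ ⟨μ, hμ, rfl⟩
    rw [Finset.mem_coe, Finset.mem_powerset]
    rintro ⟨i, j⟩ h
    rw [Finset.mem_product, Finset.mem_range, Finset.mem_range]
    have h1 : i < μ.colLen j := YoungDiagram.mem_iff_lt_colLen.mp h
    have h2 : j < μ.rowLen i := YoungDiagram.mem_iff_lt_rowLen.mp h
    have h3 : μ.colLen j ≤ μ.card := by
      rw [YoungDiagram.colLen_eq_card]
      exact Finset.card_le_card (Finset.filter_subset _ _)
    have h4 : μ.rowLen i ≤ μ.card := by
      rw [YoungDiagram.rowLen_eq_card]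
      exact Finset.card_le_card (Finset.filter_subset _ _)
    rw [show μ.card = n from hμ] at h3 h4
    exact ⟨h1.trans_le h3, h2.trans_le h4⟩
  · intro μ _ ν _ h
    exact diagram_ext fun d => by rw [← YoungDiagram.mem_cells, h, YoungDiagram.mem_cells]

/-- The partitions of `n`. -/
noncomputable def diagrams (n : ℕ) : Finset YoungDiagram := (finite_diagrams n).toFinset

theorem mem_diagrams {n : ℕ} {μ : YoungDiagram} : μ ∈ diagrams n ↔ μ.card = n := by
  simp [diagrams]

/-- Sum `f^λ f^μ` over the edges `μ ⊂ λ` of Young's lattice between levels `n` and `n + 1`. Grouping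
by `λ` gives the sum of squares at level `n + 1`; grouping by `μ` gives `n + 1` times that at level
`n`. -/
theorem sum_numStandard_sq (n : ℕ) :
    ∑ μ ∈ diagrams n, numStandard μ * numStandard μ = n.factorial := by
  induction n with
  | zero =>
    have : diagrams 0 = {⊥} := by
      ext μ
      rw [mem_diagrams, Finset.mem_singleton]
      refine ⟨fun h => diagram_ext fun d => ?_, fun h => by rw [h]; rfl⟩
      rw [← YoungDiagram.mem_cells, Finset.card_eq_zero.mp h]
      simp
    rw [this, Finset.sum_singleton, numStandard_bot]
    rfl
  | succ n ih =>
    have h1 : ∀ μ ∈ diagrams (n + 1), numStandard μ * numStandard μ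
        = ∑ y ∈ removables μ, numStandard μ * numStandard (removeBox μ y) := fun μ hμ => by
      rw [mem_diagrams] at hμ
      rw [← Finset.mul_sum, ← numStandard_eq_sum μ (by omega)]
    have h2 : ∀ μ ∈ diagrams n, ∑ x ∈ addables μ, numStandard (addBox μ x) * numStandard μ
        = (n + 1) * (numStandard μ * numStandard μ) := fun μ hμ => by
      rw [mem_diagrams] at hμ
      rw [← Finset.sum_mul, sum_addables_numStandard, hμ, mul_assoc]
    rw [Finset.sum_congr rfl h1, Nat.factorial_succ, ← ih, Finset.mul_sum,
      ← Finset.sum_congr rfl h2, Finset.sum_sigma', Finset.sum_sigma']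
    refine Finset.sum_nbij' (fun p => ⟨removeBox p.1 p.2, p.2⟩) (fun p => ⟨addBox p.1 p.2, p.2⟩)
      ?_ ?_ ?_ ?_ ?_
    · rintro ⟨μ, y⟩ h
      simp only [Finset.mem_sigma, mem_diagrams, mem_removables, mem_addables] at h ⊢
      have := card_removeBox h.2
      exact ⟨by omega, addable_removeBox_self h.2⟩
    · rintro ⟨μ, x⟩ h
      simp only [Finset.mem_sigma, mem_diagrams, mem_removables, mem_addables] at h ⊢
      have := card_addBox h.2
      exact ⟨by omega, removable_addBox_self h.2⟩
    · rintro ⟨μ, y⟩ h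
      simp only [Finset.mem_sigma, mem_diagrams, mem_removables] at h ⊢
      rw [addBox_removeBox_self h.2]
    · rintro ⟨μ, x⟩ h
      simp only [Finset.mem_sigma, mem_diagrams, mem_addables] at h ⊢
      rw [removeBox_addBox_self h.2]
    · rintro ⟨μ, y⟩ h
      simp only [Finset.mem_sigma, mem_diagrams, mem_removables] at h ⊢
      rw [addBox_removeBox_self h.2]

end YoungLattice

end AlphaDet

namespace AlphaDet

open Equiv MonoidAlgebra

/-! ### Young symmetrizers of standard tableaux in the group algebra -/

section Tableaux

variable {n : ℕ}

/-- The standard tableaux with `n` boxes, of all shapes. -/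
abbrev Tab (n : ℕ) : Type := Σ μ : {μ : YoungDiagram // μ.card = n}, StandardTableau μ.1

instance : Finite {μ : YoungDiagram // μ.card = n} := (finite_diagrams n).to_subtype

noncomputable instance : Fintype {μ : YoungDiagram // μ.card = n} := Fintype.ofFinite _

noncomputable instance (μ : YoungDiagram) : Fintype (StandardTableau μ) := Fintype.ofFinite _

/-- The numbering of the boxes by `Fin n`. -/
def Tab.num (T : Tab n) : T.1.1.cells ≃ Fin n := T.2.1.trans (finCongr T.1.2)

/-- The row of an entry. -/
def Tab.row (T : Tab n) (x : Fin n) : ℕ := (T.num.symm x : ℕ × ℕ).1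

/-- The column of an entry. -/
def Tab.col (T : Tab n) (x : Fin n) : ℕ := (T.num.symm x : ℕ × ℕ).2

theorem Tab.eq_of_row_col (T : Tab n) {x y : Fin n} (h1 : T.row x = T.row y)
    (h2 : T.col x = T.col y) : x = y :=
  T.num.symm.injective (Subtype.ext (Prod.ext h1 h2))

theorem Tab.mem (T : Tab n) (x : Fin n) : (T.row x, T.col x) ∈ T.1.1 := (T.num.symm x).2

theorem Tab.num_row_col (T : Tab n) (x : Fin n) (h : (T.row x, T.col x) ∈ T.1.1.cells) :
    T.num ⟨(T.row x, T.col x), h⟩ = x := T.num.apply_symm_apply x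

theorem Tab.row_num (T : Tab n) (c : T.1.1.cells) : T.row (T.num c) = (c : ℕ × ℕ).1 := by
  rw [Tab.row, Equiv.symm_apply_apply]

theorem Tab.col_num (T : Tab n) (c : T.1.1.cells) : T.col (T.num c) = (c : ℕ × ℕ).2 := by
  rw [Tab.col, Equiv.symm_apply_apply]

theorem Tab.num_le (T : Tab n) {c d : T.1.1.cells} (h : (c : ℕ × ℕ) ≤ d) : T.num c ≤ T.num d := by
  rcases h.eq_or_lt with h | h
  · rw [Subtype.ext h]
  · exact (T.2.lt_of_lt h).le

/-- The entries of a tableau in the order of reading by rows, with `⊤` off the diagram. -/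
noncomputable def Tab.key (T : Tab n) : Lex (ℕ ×ₗ ℕ → WithTop ℕ) :=
  toLex fun c => if h : ofLex c ∈ T.1.1.cells then ((T.num ⟨_, h⟩ : ℕ) : WithTop ℕ) else ⊤

theorem Tab.key_of_mem (T : Tab n) {c : ℕ × ℕ} (h : c ∈ T.1.1.cells) :
    ofLex T.key (toLex c) = ((T.num ⟨c, h⟩ : ℕ) : WithTop ℕ) := dif_pos h

theorem Tab.mem_of_key (T : Tab n) {c : ℕ × ℕ} {x : Fin n}
    (h : ofLex T.key (toLex c) = ((x : ℕ) : WithTop ℕ)) :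
    ∃ hc : c ∈ T.1.1.cells, T.num ⟨c, hc⟩ = x := by
  by_cases hc : c ∈ T.1.1.cells
  · refine ⟨hc, ?_⟩
    rw [T.key_of_mem hc] at h
    exact Fin.ext (WithTop.coe_injective h)
  · have : ofLex T.key (toLex c) = ⊤ := dif_neg hc
    rw [this] at h
    exact absurd h (WithTop.coe_ne_top).symm

theorem Tab.key_injective : Function.Injective (Tab.key : Tab n → _) := by
  intro T T' h
  have h1 : ∀ c (hc : c ∈ T.1.1.cells), ∃ hc' : c ∈ T'.1.1.cells,
      T'.num ⟨c, hc'⟩ = T.num ⟨c, hc⟩ := fun c hc =>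
    T'.mem_of_key (by rw [← h, T.key_of_mem hc])
  have h2 : ∀ c (_ : c ∈ T'.1.1.cells), c ∈ T.1.1.cells := fun c hc =>
    (T.mem_of_key (by rw [h, T'.key_of_mem hc])).1
  obtain ⟨⟨μ, hμ⟩, T⟩ := T
  obtain ⟨⟨ν, hν⟩, T'⟩ := T'
  have hμν : μ = ν := diagram_ext fun d => ⟨fun hd => (h1 d hd).1, fun hd => h2 d hd⟩
  subst hμν
  congr 1
  refine Subtype.ext (Equiv.ext fun c => ?_)
  obtain ⟨_, h3⟩ := h1 c c.2
  exact ((finCongr hμ).injective h3).symm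

/-- Take the first box `(i, j)`, reading by rows, where the tableaux differ. The entry `x` of `T`
there lies in `T'` in an earlier column `j'`, and the common entry of both tableaux at `(i, j')` is
the partner of `x`. -/
theorem Tab.exists_pair_of_key_lt {T T' : Tab n} (h : T.key < T'.key) :
    ∃ x y, x ≠ y ∧ T.row x = T.row y ∧ T'.col x = T'.col y := by
  obtain ⟨c, hc1, hc2⟩ := h
  obtain ⟨⟨i, j⟩, rfl⟩ := toLex.surjective c
  have hc1 : ∀ d : ℕ × ℕ, toLex d < toLex (i, j) →
      ofLex T.key (toLex d) = ofLex T'.key (toLex d) := fun d hd => hc1 _ hd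
  have hc2 : ofLex T.key (toLex (i, j)) < ofLex T'.key (toLex (i, j)) := hc2
  have hij : (i, j) ∈ T.1.1.cells := by
    by_contra hn
    have : ofLex T.key (toLex (i, j)) = ⊤ := dif_neg hn
    rw [this] at hc2
    exact not_top_lt hc2
  rw [T.key_of_mem hij] at hc2
  set x := T.num ⟨(i, j), hij⟩ with hx
  have hmem := T'.mem x
  set i' := T'.row x with hi'
  set j' := T'.col x with hj'
  have hkx : T'.num ⟨(i', j'), hmem⟩ = x := T'.num_row_col x hmem
  -- At an earlier box the tableaux agree, so `x` would occur twice in `T`.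
  have hle : toLex (i, j) ≤ toLex (i', j') := by
    by_contra! hlt
    have h1 := hc1 _ hlt
    rw [T'.key_of_mem hmem, hkx] at h1
    obtain ⟨hm, h2⟩ := T.mem_of_key h1
    have h3 := congrArg Subtype.val (T.num.injective (h2.trans hx))
    simp only at h3
    rw [h3] at hlt
    exact lt_irrefl _ hlt
  rw [Prod.Lex.toLex_le_toLex] at hle
  simp only at hle
  -- Otherwise `(i, j)` is weakly above and to the left of `x` in `T'`, so `T'` has an entry at most
  -- `x` there, against the choice of `(i, j)`.
  have hj : j' < j := by
    by_contra! hjj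
    have hle' : (i, j) ≤ (i', j') := ⟨by omega, hjj⟩
    have hm : (i, j) ∈ T'.1.1.cells := T'.1.1.isLowerSet hle' hmem
    rw [T'.key_of_mem hm] at hc2
    have h1 := T'.num_le (c := ⟨(i, j), hm⟩) (d := ⟨(i', j'), hmem⟩) hle'
    rw [hkx] at h1
    have h2 := WithTop.coe_lt_coe.mp hc2
    have h3 := Fin.le_def.mp h1
    exact absurd (Nat.cast_lt.mp h2) (by simpa using h3)
  have hm : (i, j') ∈ T.1.1.cells :=
    T.1.1.isLowerSet (show (i, j') ≤ (i, j) from ⟨le_rfl, hj.le⟩) hij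
  have h1 := hc1 (i, j') (by rw [Prod.Lex.toLex_lt_toLex]; exact Or.inr ⟨rfl, hj⟩)
  rw [T.key_of_mem hm] at h1
  obtain ⟨hm', h2⟩ := T'.mem_of_key h1.symm
  refine ⟨x, T.num ⟨(i, j'), hm⟩, ?_, ?_, ?_⟩
  · intro he
    have := congrArg Subtype.val (T.num.injective he)
    simp only [Prod.mk.injEq, true_and] at this
    omega
  · rw [hx, T.row_num, T.row_num]
  · rw [← h2, T'.col_num]

/-- The row symmetrizer. -/
noncomputable def Tab.rowSum (T : Tab n) : PermAlg (Fin n) := stabSum 1 T.row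

/-- The column antisymmetrizer. -/
noncomputable def Tab.colSum (T : Tab n) : PermAlg (Fin n) := stabSum Perm.sign T.col

/-- The Young symmetrizer of a tableau. -/
noncomputable def Tab.young (T : Tab n) : PermAlg (Fin n) := T.rowSum * T.colSum

theorem Tab.colSum_mul_rowSum_of_key_lt {T T' : Tab n} (h : T.key < T'.key) :
    T'.colSum * T.rowSum = 0 := by
  obtain ⟨x, y, hxy, h1, h2⟩ := T.exists_pair_of_key_lt h
  exact stabSum_sign_mul_one hxy h2 h1

theorem Tab.young_mul_eq_zero (T : Tab n) (x : PermAlg (Fin n))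
    (h : T.colSum * (T.young * x) = 0) : T.young * x = 0 := by
  rw [Tab.young, mul_assoc] at h ⊢
  exact stabSum_mul_mul_eq_zero _ _ _ _ _ h

/-- The right ideals generated by the Young symmetrizers of the standard tableaux are
independent. -/
theorem Tab.young_independent (x : Tab n → PermAlg (Fin n)) (h : ∑ T, T.young * x T = 0)
    (T : Tab n) : T.young * x T = 0 := by
  classical
  -- Take the nonzero term with the largest key: its column sum kills the row sums of all tableaux
  -- with smaller key, hence isolates it.
  by_contra hT
  obtain ⟨S, hS, hmax⟩ := Finset.exists_max_image
    (Finset.univ.filter fun T : Tab n => T.young * x T ≠ 0) Tab.key ⟨T, by simpa using hT⟩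
  simp only [Finset.mem_filter, Finset.mem_univ, true_and] at hS hmax
  apply hS
  apply S.young_mul_eq_zero
  have h1 := congrArg (S.colSum * ·) h
  simp only [mul_zero, Finset.mul_sum] at h1
  rw [Finset.sum_eq_single S] at h1
  · exact h1
  · intro R _ hRS
    by_cases hR : R.young * x R = 0
    · rw [hR, mul_zero]
    · have h2 : R.key < S.key := lt_of_le_of_ne (hmax R hR) (Tab.key_injective.ne hRS)
      rw [Tab.young, ← mul_assoc, ← mul_assoc, Tab.colSum_mul_rowSum_of_key_lt h2, zero_mul,
        zero_mul]
  · simp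

/-- If `R C R = 0` for the row sum `R` and column sum `C`, positivity gives `C R = 0`; but row and
column stabilizers intersect trivially. -/
theorem Tab.young_mul_rowSum_ne_zero (T : Tab n) : T.young * T.rowSum ≠ 0 := by
  intro h
  have h1 := stabSum_mul_mul_eq_zero 1 Perm.sign T.row T.col 1 (by
    rw [mul_one, ← mul_assoc]; exact h)
  rw [mul_one] at h1
  exact stabSum_mul_stabSum_ne_zero _ _ _ _ (fun i j h1 h2 => T.eq_of_row_col h2 h1) h1

instance : Module.Finite ℂ (PermAlg (Fin n)) :=
  Module.Finite.of_basis (MonoidAlgebra.basis (Perm (Fin n)) ℂ)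

/-- The right ideal generated by the Young symmetrizer. -/
noncomputable def Tab.ideal (T : Tab n) : Submodule ℂ (PermAlg (Fin n)) :=
  LinearMap.range (LinearMap.mulLeft ℂ T.young)

theorem Tab.mem_ideal (T : Tab n) {x : PermAlg (Fin n)} : x ∈ T.ideal ↔ ∃ y, T.young * y = x :=
  Iff.rfl

theorem single_mul_eq_zero {τ : Perm (Fin n)} {x : PermAlg (Fin n)}
    (h : single τ 1 * x = 0) : x = 0 := by
  have h1 := congrArg (single τ⁻¹ 1 * ·) h
  simp only [mul_zero, ← mul_assoc, single_mul_single, inv_mul_cancel, mul_one] at h1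
  rwa [← MonoidAlgebra.one_def, one_mul] at h1

/-- For each standard tableau `S` of the shape of `T`, let `τ_S` carry `S` to `T`. The elements `c_T
τ_S = τ_S c_S` lie in the ideal and are independent by triangularity under right multiplication with
row sums. -/
theorem Tab.numStandard_le_finrank (T : Tab n) : numStandard T.1.1 ≤ Module.finrank ℂ T.ideal := by
  classical
  let τ : StandardTableau T.1.1 → Perm (Fin n) := fun S => (Tab.num ⟨T.1, S⟩).symm.trans T.num
  have hrow : ∀ S, T.row ∘ τ S = Tab.row ⟨T.1, S⟩ := fun S => by
    funext x; simp [Tab.row, τ]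
  have hcol : ∀ S, T.col ∘ τ S = Tab.col ⟨T.1, S⟩ := fun S => by
    funext x; simp [Tab.col, τ]
  have hu : ∀ S, T.young * single (τ S) 1 = single (τ S) 1 * Tab.young ⟨T.1, S⟩ := fun S => by
    rw [Tab.young, Tab.young, mul_assoc, Tab.colSum, ← stabSum_conj, hcol, ← mul_assoc, Tab.rowSum,
      ← stabSum_conj, hrow, mul_assoc]
    rfl
  let u : StandardTableau T.1.1 → T.ideal := fun S => ⟨T.young * single (τ S) 1, _, rfl⟩
  have hli : LinearIndependent ℂ u := by
    rw [Fintype.linearIndependent_iff]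
    intro z hz
    by_contra! hne
    obtain ⟨S₀, hS₀⟩ := hne
    obtain ⟨S, hS, hmin⟩ := Finset.exists_min_image
      (Finset.univ.filter fun S => z S ≠ 0) (fun S => Tab.key ⟨T.1, S⟩) ⟨S₀, by simpa using hS₀⟩
    simp only [Finset.mem_filter, Finset.mem_univ, true_and] at hS hmin
    have h1 : ∑ R, z R • (single (τ R) 1 * Tab.young ⟨T.1, R⟩) = 0 := by
      have := congrArg Subtype.val hz
      simpa [u, hu] using this
    -- For the smallest key `S` with nonzero coefficient, this row sum is killed by the column sums
    -- of all tableaux with larger key, so only the term of `S` survives.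
    have h2 := congrArg (· * Tab.rowSum ⟨T.1, S⟩) h1
    simp only [zero_mul, Finset.sum_mul] at h2
    rw [Finset.sum_eq_single S] at h2
    · rw [smul_mul_assoc, mul_assoc] at h2
      exact Tab.young_mul_rowSum_ne_zero _
        (single_mul_eq_zero ((smul_eq_zero.mp h2).resolve_left hS))
    · intro R _ hRS
      by_cases hR : z R = 0
      · rw [hR, zero_smul, zero_mul]
      · have h3 : Tab.key ⟨T.1, S⟩ < Tab.key ⟨T.1, R⟩ := by
          refine lt_of_le_of_ne (hmin R hR) (Tab.key_injective.ne ?_)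
          intro h
          exact hRS (eq_of_heq (Sigma.mk.inj h).2).symm
        have h4 : Tab.young ⟨T.1, R⟩ * Tab.rowSum ⟨T.1, S⟩ = 0 := by
          rw [Tab.young, mul_assoc, Tab.colSum_mul_rowSum_of_key_lt h3, mul_zero]
        rw [smul_mul_assoc, mul_assoc, h4, mul_zero, smul_zero]
    · simp
  have := hli.fintype_card_le_finrank
  rwa [← Nat.card_eq_fintype_card] at this

theorem finrank_permAlg : Module.finrank ℂ (PermAlg (Fin n)) = n.factorial := by
  rw [Module.finrank_eq_card_basis (MonoidAlgebra.basis (Perm (Fin n)) ℂ), Fintype.card_perm,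
    Fintype.card_fin]

theorem sum_numStandard_tab : ∑ T : Tab n, numStandard T.1.1 = n.factorial := by
  rw [← sum_numStandard_sq, Fintype.sum_sigma]
  have h : ∀ μ : {μ : YoungDiagram // μ.card = n},
      ∑ _S : StandardTableau μ.1, numStandard μ.1 = numStandard μ.1 * numStandard μ.1 := fun μ => by
    rw [Finset.sum_const, Finset.card_univ, ← Nat.card_eq_fintype_card]
    rfl
  rw [Finset.sum_congr rfl fun μ _ => h μ]
  exact (Finset.sum_subtype (diagrams n) (fun μ => mem_diagrams)
    fun μ => numStandard μ * numStandard μ).symm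

/-- The group algebra is the sum of the right ideals generated by the Young symmetrizers of the
standard tableaux. -/
theorem Tab.exists_sum_young (x : PermAlg (Fin n)) :
    ∃ y : Tab n → PermAlg (Fin n), x = ∑ T, T.young * y T := by
  let Θ : (∀ T : Tab n, T.ideal) →ₗ[ℂ] PermAlg (Fin n) :=
    ∑ T, T.ideal.subtype ∘ₗ LinearMap.proj T
  have hΘ : ∀ v, Θ v = ∑ T, (v T : PermAlg (Fin n)) := fun v => by
    simp [Θ, LinearMap.sum_apply]
  have hinj : Function.Injective Θ := by
    rw [← LinearMap.ker_eq_bot, LinearMap.ker_eq_bot']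
    intro v hv
    rw [hΘ] at hv
    choose y hy using fun T : Tab n => T.mem_ideal.mp (v T).2
    simp only [← hy] at hv
    funext T
    refine Subtype.ext ?_
    rw [← hy]
    exact Tab.young_independent y hv T
  -- Injectivity bounds the total dimension above by `n!`; the lower bounds `f^μ`, one for each of
  -- the `f^μ` tableaux of shape `μ`, add up to `n!` as well.
  have hfin : Module.finrank ℂ (∀ T : Tab n, T.ideal) = Module.finrank ℂ (PermAlg (Fin n)) := by
    refine le_antisymm (LinearMap.finrank_le_finrank_of_injective hinj) ?_
    rw [finrank_permAlg, ← sum_numStandard_tab, Module.finrank_pi_fintype]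
    exact Finset.sum_le_sum fun T _ => T.numStandard_le_finrank
  obtain ⟨v, hv⟩ := (LinearMap.injective_iff_surjective_of_finrank_eq_finrank hfin).mp hinj x
  choose y hy using fun T : Tab n => T.mem_ideal.mp (v T).2
  refine ⟨y, ?_⟩
  rw [← hv, hΘ]
  exact Finset.sum_congr rfl fun T _ => (hy T).symm

open Classical in
/-- The projections of the decomposition of the group algebra into right ideals. -/
theorem Tab.exists_projections : ∃ y : Tab n → PermAlg (Fin n), ∑ T, T.young * y T = 1 ∧
    ∀ T S : Tab n, T.young * y T * S.young = if T = S then S.young else 0 := by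
  obtain ⟨y, hy⟩ := Tab.exists_sum_young (1 : PermAlg (Fin n))
  refine ⟨y, hy.symm, fun T S => ?_⟩
  -- Both `1 · c_S = ∑_R c_R y_R c_S` and `c_S` itself expand `c_S` in the ideals; independence
  -- compares the components.
  have h : ∑ R : Tab n, R.young * (y R * S.young - if R = S then 1 else 0) = 0 := by
    simp only [mul_sub, Finset.sum_sub_distrib, ← mul_assoc, ← Finset.sum_mul, ← hy, one_mul,
      mul_ite, mul_one, mul_zero, Finset.sum_ite_eq', Finset.mem_univ, if_true, sub_self]
  have h1 := Tab.young_independent _ h T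
  rw [mul_sub, ← mul_assoc, sub_eq_zero] at h1
  rw [h1]
  split_ifs with hTS
  · rw [hTS, mul_one]
  · rw [mul_zero]

end Tableaux

/-! ### The element `∑_σ α^{n - ν(σ)} σ` for `α = ±1/k` -/

section Special

variable {n : ℕ}

/-- The coefficient of `σ` on the left is `χ(σ) k^{ν(σ)}`, and `k^{ν(σ)}` is the number of
colourings `f` stabilized by `σ`. -/
theorem smul_alphaElt (χ : Perm (Fin n) →* ℤˣ) (ε : ℂ) (k : ℕ) (hk : 1 ≤ k)
    (hε : ∀ σ : Perm (Fin n), ε ^ (n - numCycles σ) = ((χ σ : ℤ) : ℂ)) :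
    ((k : ℂ) ^ n) • alphaElt n (ε * (1 / (k : ℂ))) = ∑ f : Fin n → Fin k, stabSum χ f := by
  have hk0 : (k : ℂ) ≠ 0 := by rw [Nat.cast_ne_zero]; omega
  simp only [stabSum, Finset.sum_filter]
  rw [Finset.sum_comm, alphaElt, Finset.smul_sum]
  refine Finset.sum_congr rfl fun σ _ => ?_
  have hs : ∑ f : Fin n → Fin k, (if ∀ i, f (σ i) = f i then
      ((χ σ : ℤ) : ℂ) • (single σ 1 : PermAlg (Fin n)) else 0)
      = ((k : ℂ) ^ numCycles σ * ((χ σ : ℤ) : ℂ)) • single σ 1 := by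
    rw [← Finset.sum_filter, Finset.sum_const, ← Fintype.card_subtype, card_invariantFun,
      ← Nat.cast_smul_eq_nsmul ℂ, smul_smul, Nat.cast_pow]
  refine Eq.trans ?_ (hs.symm.trans (Finset.sum_congr rfl fun f _ => by congr))
  rw [smul_smul, mul_pow, hε]
  congr 1
  have h : (k : ℂ) ^ n = (k : ℂ) ^ (n - numCycles σ) * (k : ℂ) ^ numCycles σ := by
    rw [← pow_add, Nat.sub_add_cancel (numCycles_le σ)]
  rw [h, one_div, inv_pow]
  field_simp

theorem smul_alphaElt_pos (k : ℕ) (hk : 1 ≤ k) :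
    ((k : ℂ) ^ n) • alphaElt n (1 / (k : ℂ)) = ∑ f : Fin n → Fin k, stabSum 1 f := by
  rw [← smul_alphaElt 1 1 k hk (by simp), one_mul]

theorem smul_alphaElt_neg (k : ℕ) (hk : 1 ≤ k) :
    ((k : ℂ) ^ n) • alphaElt n (-(1 / (k : ℂ))) = ∑ f : Fin n → Fin k, stabSum Perm.sign f := by
  rw [← smul_alphaElt Perm.sign (-1) k hk neg_one_pow_sub_numCycles, neg_one_mul]

theorem pow_natCast_ne_zero {k : ℕ} (hk : 1 ≤ k) : ((k : ℂ) ^ n) ≠ 0 :=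
  pow_ne_zero _ (by rw [Nat.cast_ne_zero]; omega)

/-- Centrality moves `alphaElt` next to the column sum. By pigeonhole each colouring agrees on two
boxes of the first column, whose transposition is symmetrized on one side and antisymmetrized on the
other. -/
theorem Tab.alphaElt_pos_mul_young_eq_zero (T : Tab n) (k : ℕ) (hk : 1 ≤ k)
    (hT : k < T.1.1.colLen 0) : alphaElt n (1 / (k : ℂ)) * T.young = 0 := by
  have h : ((k : ℂ) ^ n) • (alphaElt n (1 / (k : ℂ)) * T.young) = 0 := by
    rw [Tab.young, ← mul_assoc, ← alphaElt_central, mul_assoc, ← mul_smul_comm, ← smul_mul_assoc,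
      smul_alphaElt_pos k hk, Finset.sum_mul, Finset.sum_eq_zero, mul_zero]
    intro f _
    have hm : ∀ i : Fin (T.1.1.colLen 0), ((i : ℕ), 0) ∈ T.1.1.cells := fun i =>
      YoungDiagram.mem_iff_lt_colLen.mpr i.2
    obtain ⟨i, j, hij, hf⟩ := Fintype.exists_ne_map_eq_of_card_lt
      (fun i : Fin (T.1.1.colLen 0) => f (T.num ⟨(i, 0), hm i⟩)) (by simpa using hT)
    refine stabSum_one_mul_sign (i := T.num ⟨(i, 0), hm i⟩) (j := T.num ⟨(j, 0), hm j⟩) ?_ hf ?_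
    · intro h
      have := congrArg Subtype.val (T.num.injective h)
      simp only [Prod.mk.injEq, and_true] at this
      exact hij (Fin.ext this)
    · rw [T.col_num, T.col_num]
  exact (smul_eq_zero.mp h).resolve_left (pow_natCast_ne_zero hk)

/-- The same pigeonhole in the first row, with the signs exchanged; the row sum already stands on
the left. -/
theorem Tab.alphaElt_neg_mul_young_eq_zero (T : Tab n) (k : ℕ) (hk : 1 ≤ k)
    (hT : k < T.1.1.rowLen 0) : alphaElt n (-(1 / (k : ℂ))) * T.young = 0 := by
  have h : ((k : ℂ) ^ n) • (alphaElt n (-(1 / (k : ℂ))) * T.young) = 0 := by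
    rw [Tab.young, ← mul_assoc, ← smul_mul_assoc, ← smul_mul_assoc,
      smul_alphaElt_neg k hk, Finset.sum_mul, Finset.sum_eq_zero, zero_mul]
    intro f _
    have hm : ∀ j : Fin (T.1.1.rowLen 0), (0, (j : ℕ)) ∈ T.1.1.cells := fun j =>
      YoungDiagram.mem_iff_lt_rowLen.mpr j.2
    obtain ⟨i, j, hij, hf⟩ := Fintype.exists_ne_map_eq_of_card_lt
      (fun j : Fin (T.1.1.rowLen 0) => f (T.num ⟨(0, j), hm j⟩)) (by simpa using hT)
    refine stabSum_sign_mul_one (i := T.num ⟨(0, i), hm i⟩) (j := T.num ⟨(0, j), hm j⟩) ?_ hf ?_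
    · intro h
      have := congrArg Subtype.val (T.num.injective h)
      simp only [Prod.mk.injEq, true_and] at this
      exact hij (Fin.ext this)
    · rw [T.row_num, T.row_num]
  exact (smul_eq_zero.mp h).resolve_left (pow_natCast_ne_zero hk)

/-- Positivity lets one colouring be singled out: the row function, which uses at most `k` colours.
Its stabilizer sum is the row sum, which acts on `c_T x` by a nonzero scalar. -/
theorem Tab.alphaElt_pos_injective (T : Tab n) (k : ℕ) (hk : 1 ≤ k) (hT : T.1.1.colLen 0 ≤ k)
    (x : PermAlg (Fin n)) (hx : alphaElt n (1 / (k : ℂ)) * (T.young * x) = 0) :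
    T.young * x = 0 := by
  have h1 : (∑ f : Fin n → Fin k, stabSum 1 f) * (T.young * x) = 0 := by
    rw [← smul_alphaElt_pos k hk, smul_mul_assoc, hx, smul_zero]
  let f : Fin n → Fin k := fun i => ⟨T.row i, lt_of_lt_of_le
    (YoungDiagram.mem_iff_lt_colLen.mp
      (T.1.1.up_left_mem le_rfl (Nat.zero_le _) (T.mem i))) hT⟩
  have h2 := stabSum_mul_eq_zero_of_sum Finset.univ 1 (fun f : Fin n → Fin k => f) _ h1 f
    (Finset.mem_univ f)
  have h3 : stabSum 1 f = T.rowSum := (stabSum_comp_of_injective 1 f Fin.val_injective).symm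
  rw [h3, Tab.young, ← mul_assoc, ← mul_assoc, Tab.rowSum, stabSum_mul_self, smul_mul_assoc,
    smul_mul_assoc] at h2
  exact (smul_eq_zero.mp h2).resolve_left (stabCard_ne_zero _)

/-- Here the column function is the colouring singled out; the column sum of `T` is injective on its
ideal, again by positivity. -/
theorem Tab.alphaElt_neg_injective (T : Tab n) (k : ℕ) (hk : 1 ≤ k) (hT : T.1.1.rowLen 0 ≤ k)
    (x : PermAlg (Fin n)) (hx : alphaElt n (-(1 / (k : ℂ))) * (T.young * x) = 0) :
    T.young * x = 0 := by
  have h1 : (∑ f : Fin n → Fin k, stabSum Perm.sign f) * (T.young * x) = 0 := by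
    rw [← smul_alphaElt_neg k hk, smul_mul_assoc, hx, smul_zero]
  let f : Fin n → Fin k := fun i => ⟨T.col i, lt_of_lt_of_le
    (YoungDiagram.mem_iff_lt_rowLen.mp
      (T.1.1.up_left_mem (Nat.zero_le _) le_rfl (T.mem i))) hT⟩
  have h2 := stabSum_mul_eq_zero_of_sum Finset.univ Perm.sign (fun f : Fin n → Fin k => f) _ h1 f
    (Finset.mem_univ f)
  have h3 : stabSum Perm.sign f = T.colSum :=
    (stabSum_comp_of_injective Perm.sign f Fin.val_injective).symm
  rw [h3] at h2
  exact T.young_mul_eq_zero x h2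

/-- Left multiplication by the central `alphaElt` preserves the finite-dimensional right ideal, so
injectivity there implies surjectivity. -/
theorem Tab.exists_young_eq (T : Tab n) (α : ℂ)
    (h : ∀ x, alphaElt n α * (T.young * x) = 0 → T.young * x = 0) :
    ∃ y, T.young = alphaElt n α * y := by
  let F : Module.End ℂ T.ideal := (LinearMap.mulLeft ℂ (alphaElt n α)).restrict
    (p := T.ideal) (q := T.ideal) (by
      rintro _ ⟨x, rfl⟩
      refine ⟨alphaElt n α * x, ?_⟩
      rw [LinearMap.mulLeft_apply, LinearMap.mulLeft_apply, LinearMap.mulLeft_apply, ← mul_assoc,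
        ← mul_assoc, alphaElt_central])
  have hinj : Function.Injective F := by
    rw [← LinearMap.ker_eq_bot, LinearMap.ker_eq_bot']
    rintro ⟨_, x, rfl⟩ hx
    exact Subtype.ext (h x (congrArg Subtype.val hx))
  obtain ⟨w, hw⟩ := LinearMap.injective_iff_surjective.mp hinj
    ⟨T.young, 1, by rw [LinearMap.mulLeft_apply, mul_one]⟩
  exact ⟨w, (congrArg Subtype.val hw).symm⟩

end Special

end AlphaDet

namespace AlphaDet

open Equiv MonoidAlgebra

/-! ### The group algebra acting on tensors -/

section Action

variable {n : ℕ}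

/-- The places are permuted by a right action, hence the inverse in the left action `act`. -/
theorem permute_mul {ι : Type} (σ τ : Perm ι) :
    permute n (σ * τ) = permute n τ ∘ₗ permute n σ := by
  refine PiTensorProduct.ext (MultilinearMap.ext fun v => ?_)
  change permute n (σ * τ) (PiTensorProduct.tprod ℂ v)
    = permute n τ (permute n σ (PiTensorProduct.tprod ℂ v))
  simp only [permute_tprod, Perm.mul_apply]

theorem permute_one {ι : Type} : permute n (1 : Perm ι) = LinearMap.id := by
  refine PiTensorProduct.ext (MultilinearMap.ext fun v => ?_)
  change permute n 1 (PiTensorProduct.tprod ℂ v) = PiTensorProduct.tprod ℂ v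
  simp only [permute_tprod, Perm.one_apply]

/-- The left action of the group algebra on tensors by permutation of the factors. -/
noncomputable def act (n : ℕ) : PermAlg (Fin n) →ₐ[ℂ] Module.End ℂ (Tensor n (Fin n)) :=
  MonoidAlgebra.lift ℂ _ _
    { toFun := fun σ => permute n σ⁻¹
      map_one' := by rw [inv_one, permute_one]; rfl
      map_mul' := fun σ τ => by rw [mul_inv_rev, permute_mul]; rfl }

theorem act_single (σ : Perm (Fin n)) : act n (single σ 1) = permute n σ⁻¹ := by
  simp [act]

theorem act_tensorRep (x : PermAlg (Fin n)) (A : gl n) (t : Tensor n (Fin n)) :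
    act n x (tensorRep n (Fin n) A t) = tensorRep n (Fin n) A (act n x t) := by
  induction x using MonoidAlgebra.induction_linear with
  | zero => simp
  | add x y hx hy => rw [map_add, LinearMap.add_apply, LinearMap.add_apply, hx, hy, map_add]
  | single σ c =>
    have : (single σ c : PermAlg (Fin n)) = c • single σ 1 := by simp
    rw [this, map_smul, LinearMap.smul_apply, LinearMap.smul_apply, act_single, permute_tensorRep,
      map_smul]

/-- Renaming of the tensor factors. -/
noncomputable def rename (n : ℕ) {ι κ : Type} (e : ι ≃ κ) : Tensor n ι ≃ₗ[ℂ] Tensor n κ :=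
  PiTensorProduct.reindex ℂ (fun _ : ι => (Fin n → ℂ)) e

theorem rename_tprod {ι κ : Type} (e : ι ≃ κ) (v : ι → Fin n → ℂ) :
    rename n e (PiTensorProduct.tprod ℂ v) = PiTensorProduct.tprod ℂ fun k => v (e.symm k) :=
  PiTensorProduct.reindex_tprod e v

theorem rename_tensorRep {ι κ : Type} [Fintype ι] [DecidableEq ι] [Fintype κ] [DecidableEq κ]
    (e : ι ≃ κ) (A : gl n) (t : Tensor n ι) :
    rename n e (tensorRep n ι A t) = tensorRep n κ A (rename n e t) := by
  suffices h : (rename n e).toLinearMap ∘ₗ tensorRep n ι A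
      = tensorRep n κ A ∘ₗ (rename n e).toLinearMap from LinearMap.congr_fun h t
  refine PiTensorProduct.ext (MultilinearMap.ext fun v => ?_)
  change rename n e ((∑ k, PiTensorProduct.map (Pi.mulSingle k (Matrix.toLin' A)))
      (PiTensorProduct.tprod ℂ v)) = (∑ k, PiTensorProduct.map (Pi.mulSingle k (Matrix.toLin' A)))
      (rename n e (PiTensorProduct.tprod ℂ v))
  rw [rename_tprod, LinearMap.sum_apply, LinearMap.sum_apply, map_sum]
  simp only [PiTensorProduct.map_tprod, rename_tprod]
  refine (Equiv.sum_comp e.symm _).symm.trans (Finset.sum_congr rfl fun k _ => ?_)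
  congr 1
  funext l
  by_cases h : l = k
  · subst h; simp
  · rw [Pi.mulSingle_eq_of_ne h, Pi.mulSingle_eq_of_ne (e.symm.injective.ne h)]

theorem rename_permute {ι κ : Type} (e : ι ≃ κ) (σ : Perm ι) (t : Tensor n ι) :
    rename n e (permute n σ t) = permute n (e.permCongr σ) (rename n e t) := by
  suffices h : (rename n e).toLinearMap ∘ₗ permute n σ
      = permute n (e.permCongr σ) ∘ₗ (rename n e).toLinearMap from LinearMap.congr_fun h t
  refine PiTensorProduct.ext (MultilinearMap.ext fun v => ?_)
  change rename n e (permute n σ (PiTensorProduct.tprod ℂ v))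
    = permute n (e.permCongr σ) (rename n e (PiTensorProduct.tprod ℂ v))
  simp only [permute_tprod, rename_tprod, Equiv.permCongr_apply, Equiv.symm_apply_apply]

/-- The inverse in `act` reverses products, so `p * q` acts on the left as the transported right
multiplication by `q * p`. Both stabilizers and the sign are invariant under inversion. -/
theorem Tab.act_young (T : Tab n) (t : Tensor n T.1.1.cells) :
    act n T.young (rename n T.num t) = rename n T.num (youngSymmetrizer n T.1.1 t) := by
  have h1 : T.young = ∑ q : Perm (Fin n) with ∀ i, T.col (q i) = T.col i,
      ∑ p : Perm (Fin n) with ∀ i, T.row (p i) = T.row i,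
        ((Perm.sign q : ℤ) : ℂ) • single (p * q) 1 := by
    rw [Tab.young, Tab.rowSum, Tab.colSum, stabSum, stabSum, Finset.sum_mul_sum, Finset.sum_comm]
    simp only [MonoidHom.one_apply, Units.val_one, Int.cast_one, one_smul, mul_smul_comm,
      single_mul_single, mul_one]
    congr!
  rw [h1, youngSymmetrizer]
  simp only [map_sum, map_smul, LinearMap.sum_apply, LinearMap.smul_apply, act_single,
    rename_permute]
  symm
  let e : Perm T.1.1.cells ≃ Perm (Fin n) := T.num.permCongr.trans (Equiv.inv _)
  have he : ∀ σ, (e σ)⁻¹ = T.num.permCongr σ := fun σ => inv_inv _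
  have hi : ∀ σ : Perm T.1.1.cells, ∀ i, T.num.symm ((e σ).symm i) = σ (T.num.symm i) := fun σ i => by
    rw [show (e σ).symm = T.num.permCongr σ from he σ, Equiv.permCongr_apply, Equiv.symm_apply_apply]
  refine Finset.sum_equiv e (fun q => ?_) (fun q _ => Finset.sum_equiv e (fun p => ?_) fun p _ => ?_)
  · simp only [colGroup, Finset.mem_filter, Finset.mem_univ, true_and]
    constructor
    · intro h i
      have h2 := h (T.num.symm (e q i))
      rw [← hi, Equiv.symm_apply_apply] at h2
      exact h2.symm
    · intro h c
      have h2 := h ((e q).symm (T.num c))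
      rw [Equiv.apply_symm_apply, Tab.col, Tab.col, hi, Equiv.symm_apply_apply] at h2
      exact h2.symm
  · simp only [rowGroup, Finset.mem_filter, Finset.mem_univ, true_and]
    constructor
    · intro h i
      have h2 := h (T.num.symm (e p i))
      rw [← hi, Equiv.symm_apply_apply] at h2
      exact h2.symm
    · intro h c
      have h2 := h ((e p).symm (T.num c))
      rw [Equiv.apply_symm_apply, Tab.row, Tab.row, hi, Equiv.symm_apply_apply] at h2
      exact h2.symm
  · congr 1
    · have : Perm.sign (e q) = Perm.sign q := by
        rw [← Perm.sign_inv, he, Perm.sign_permCongr]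
      rw [this]
    · rw [mul_inv_rev, he, he]
      congr 2
      ext i
      simp [Equiv.permCongr_apply]

/-- The Schur module as a submodule of the tensors with numbered factors. -/
noncomputable def Tab.schurHom (T : Tab n) : schurModule n T.1.1 →ₗ⁅ℂ, gl n⁆ Tensor n (Fin n) where
  toLinearMap := (rename n T.num).toLinearMap ∘ₗ (schurModule n T.1.1).toSubmodule.subtype
  map_lie' := fun {A v} => rename_tensorRep T.num A v.1

theorem Tab.schurHom_injective (T : Tab n) : Function.Injective T.schurHom :=
  (rename n T.num).injective.comp Subtype.val_injective

theorem Tab.exists_schurHom (T : Tab n) (w : Tensor n (Fin n)) :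
    ∃ v, T.schurHom v = act n T.young w := by
  refine ⟨⟨youngSymmetrizer n T.1.1 ((rename n T.num).symm w), _, rfl⟩, ?_⟩
  refine (T.act_young _).symm.trans ?_
  rw [LinearEquiv.apply_symm_apply]

theorem Tab.exists_act_young (T : Tab n) (v : schurModule n T.1.1) :
    ∃ w, T.schurHom v = act n T.young w := by
  obtain ⟨v, t, rfl⟩ := v
  exact ⟨rename n T.num t, (T.act_young t).symm⟩

end Action

/-! ### Direct sums of Lie modules -/

section DirectSum

variable {L : Type*} [LieRing L] {ι : Type*} [DecidableEq ι] {M : ι → Type*}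
  [∀ i, AddCommGroup (M i)] [∀ i, Module ℂ (M i)] [∀ i, LieRingModule L (M i)]
  {N : Type*} [AddCommGroup N] [Module ℂ N] [LieRingModule L N]

/-- The morphism from a direct sum of Lie modules given by morphisms from the summands. -/
noncomputable def sumHom (f : ∀ i, M i →ₗ⁅ℂ, L⁆ N) : (⨁ i, M i) →ₗ⁅ℂ, L⁆ N where
  toLinearMap := DirectSum.toModule ℂ ι N fun i => (f i : M i →ₗ[ℂ] N)
  map_lie' := fun {A x} => by
    change DirectSum.toModule ℂ ι N (fun i => (f i : M i →ₗ[ℂ] N)) ⁅A, x⁆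
      = ⁅A, DirectSum.toModule ℂ ι N (fun i => (f i : M i →ₗ[ℂ] N)) x⁆
    induction x using DirectSum.induction_on with
    | zero => simp
    | add x y hx hy => rw [lie_add, map_add, map_add, lie_add, hx, hy]
    | of i v =>
      have h : ⁅A, DirectSum.of M i v⁆ = DirectSum.lof ℂ ι M i ⁅A, v⁆ :=
        ((DirectSum.lieModuleOf ℂ ι L M i).map_lie A v).symm
      rw [h, ← DirectSum.lof_eq_of ℂ, DirectSum.toModule_lof, DirectSum.toModule_lof]
      exact (f i).map_lie A v

theorem sumHom_of (f : ∀ i, M i →ₗ⁅ℂ, L⁆ N) (i : ι) (v : M i) :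
    sumHom f (DirectSum.of M i v) = f i v :=
  DirectSum.toModule_lof ℂ i v

/-- The operators `p i` recover the components of an element from its image. -/
theorem sumHom_injective (f : ∀ i, M i →ₗ⁅ℂ, L⁆ N) (hf : ∀ i, Function.Injective (f i))
    (p : ι → N →ₗ[ℂ] N) (h1 : ∀ i v, p i (f i v) = f i v)
    (h2 : ∀ i j v, i ≠ j → p i (f j v) = 0) : Function.Injective (sumHom f) := by
  have key : ∀ i x, p i (sumHom f x) = f i (x i) := by
    intro i x
    induction x using DirectSum.induction_on with
    | zero => simp
    | add x y hx hy => rw [map_add, map_add, hx, hy, DirectSum.add_apply, map_add]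
    | of j v =>
      rw [sumHom_of]
      by_cases hij : i = j
      · subst hij
        rw [h1, DirectSum.of_eq_same]
      · rw [h2 i j v hij, DirectSum.of_eq_of_ne _ _ _ hij, map_zero]
  rw [injective_iff_map_eq_zero]
  intro x hx
  refine DFinsupp.ext fun i => hf i ?_
  have := key i x
  rw [hx, map_zero] at this
  rw [← this]
  exact (map_zero _).symm

theorem nonempty_equiv_of_injective {Q : Type*} [AddCommGroup Q] [Module ℂ Q] [LieRingModule L Q]
    (f : N →ₗ⁅ℂ, L⁆ Q) (hf : Function.Injective f) (K : LieSubmodule ℂ L Q)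
    (hK : ∀ q, q ∈ K ↔ ∃ x, f x = q) : Nonempty (K ≃ₗ⁅ℂ, L⁆ N) := by
  let g : N →ₗ⁅ℂ, L⁆ K :=
    { toLinearMap := (f : N →ₗ[ℂ] Q).codRestrict K.toSubmodule fun x => (hK _).mpr ⟨x, rfl⟩
      map_lie' := fun {A x} => Subtype.ext (f.map_lie A x) }
  have hg : Function.Bijective g := by
    constructor
    · intro x y hxy
      exact hf (congrArg Subtype.val hxy)
    · rintro ⟨q, hq⟩
      obtain ⟨x, rfl⟩ := (hK q).mp hq
      exact ⟨x, rfl⟩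
  let e := Equiv.ofBijective g hg
  exact ⟨LieModuleEquiv.symm
    { g with
      invFun := e.symm
      left_inv := e.left_inv
      right_inv := e.right_inv }⟩

end DirectSum

/-! ### The decomposition of the tensors -/

section Decomposition

variable {n : ℕ}

/-- The tableau with a given index. -/
noncomputable def tabOf (P : YoungDiagram → Prop) (μ : {μ : YoungDiagram // μ.card = n ∧ P μ})
    (i : Fin (numStandard μ.1)) : Tab n :=
  ⟨⟨μ.1, μ.2.1⟩, (Finite.equivFin (StandardTableau μ.1)).symm i⟩

theorem tabOf_ne (P : YoungDiagram → Prop) {μ ν : {μ : YoungDiagram // μ.card = n ∧ P μ}}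
    (h : μ ≠ ν) (i : Fin (numStandard μ.1)) (j : Fin (numStandard ν.1)) :
    tabOf P μ i ≠ tabOf P ν j := fun he =>
  h (Subtype.ext (congrArg (fun T : Tab n => T.1.1) he))

theorem tabOf_injective (P : YoungDiagram → Prop) (μ : {μ : YoungDiagram // μ.card = n ∧ P μ}) :
    Function.Injective (tabOf P μ) := fun _ _ h =>
  (Finite.equivFin (StandardTableau μ.1)).symm.injective (eq_of_heq (Sigma.mk.inj h).2)

/-- The embedding of the Schur module given by the tableau with a given index. -/
noncomputable def tabHom (P : YoungDiagram → Prop) (μ : {μ : YoungDiagram // μ.card = n ∧ P μ})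
    (i : Fin (numStandard μ.1)) : schurModule n μ.1 →ₗ⁅ℂ, gl n⁆ Tensor n (Fin n) :=
  (tabOf P μ i).schurHom

theorem tabHom_injective (P : YoungDiagram → Prop) (μ : {μ : YoungDiagram // μ.card = n ∧ P μ})
    (i : Fin (numStandard μ.1)) : Function.Injective (tabHom P μ i) :=
  (tabOf P μ i).schurHom_injective

theorem exists_tabHom (P : YoungDiagram → Prop) (μ : {μ : YoungDiagram // μ.card = n ∧ P μ})
    (i : Fin (numStandard μ.1)) (w : Tensor n (Fin n)) :
    ∃ v, tabHom P μ i v = act n (tabOf P μ i).young w :=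
  (tabOf P μ i).exists_schurHom w

theorem exists_act_tabOf (P : YoungDiagram → Prop) (μ : {μ : YoungDiagram // μ.card = n ∧ P μ})
    (i : Fin (numStandard μ.1)) (v : schurModule n μ.1) :
    ∃ w, tabHom P μ i v = act n (tabOf P μ i).young w :=
  (tabOf P μ i).exists_act_young v

open Classical in
/-- The morphism from the direct sum of Schur modules to the tensors. -/
noncomputable def schurSumHom (n : ℕ) (P : YoungDiagram → Prop) :
    schurSum n P →ₗ⁅ℂ, gl n⁆ Tensor n (Fin n) :=
  sumHom fun μ => sumHom fun i => tabHom P μ i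

theorem schurSumHom_injective (P : YoungDiagram → Prop) :
    Function.Injective (schurSumHom n P) := by
  classical
  obtain ⟨y, -, hy⟩ := Tab.exists_projections (n := n)
  have h1 : ∀ μ i v, act n ((tabOf P μ i).young * y (tabOf P μ i)) (tabHom P μ i v)
      = tabHom P μ i v := by
    intro μ i v
    obtain ⟨w, hw⟩ := exists_act_tabOf P μ i v
    rw [hw, ← Module.End.mul_apply, ← map_mul, hy, if_pos rfl]
  have h2 : ∀ (T : Tab n) μ i v, T ≠ tabOf P μ i →
      act n (T.young * y T) (tabHom P μ i v) = 0 := by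
    intro T μ i v hT
    obtain ⟨w, hw⟩ := exists_act_tabOf P μ i v
    rw [hw, ← Module.End.mul_apply, ← map_mul, hy, if_neg hT, map_zero, LinearMap.zero_apply]
  refine sumHom_injective _ (fun μ => ?_)
    -- The projection to a shape is the sum of the projections to its tableaux.
    (fun μ => ∑ i, act n ((tabOf P μ i).young * y (tabOf P μ i))) (fun μ v => ?_)
    (fun μ ν v hμν => ?_)
  · exact sumHom_injective _ (fun i => tabHom_injective P μ i)
      (fun i => act n ((tabOf P μ i).young * y (tabOf P μ i))) (fun i v => h1 μ i v)
      (fun i j v hij => h2 _ _ _ v ((tabOf_injective P μ).ne hij))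
  · induction v using DirectSum.induction_on with
    | zero => simp
    | add v w hv hw => rw [map_add, map_add, hv, hw]
    | of i v =>
      rw [sumHom_of, LinearMap.sum_apply, Finset.sum_eq_single i]
      · exact h1 μ i v
      · exact fun j _ hji => h2 _ _ _ v ((tabOf_injective P μ).ne hji)
      · simp
  · induction v using DirectSum.induction_on with
    | zero => simp
    | add v w hv hw => rw [map_add, map_add, hv, hw, add_zero]
    | of i v =>
      rw [sumHom_of, LinearMap.sum_apply, Finset.sum_eq_zero]
      exact fun j _ => h2 _ _ _ v (tabOf_ne P hμν j i)

theorem exists_schurSumHom_eq (P : YoungDiagram → Prop) (T : Tab n) (hT : P T.1.1)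
    (w : Tensor n (Fin n)) : ∃ x, schurSumHom n P x = act n T.young w := by
  classical
  let μ : {μ : YoungDiagram // μ.card = n ∧ P μ} := ⟨T.1.1, T.1.2, hT⟩
  let i : Fin (numStandard μ.1) := Finite.equivFin (StandardTableau T.1.1) T.2
  have hi : tabOf P μ i = T := by
    change (⟨T.1, (Finite.equivFin (StandardTableau T.1.1)).symm
      (Finite.equivFin (StandardTableau T.1.1) T.2)⟩ : Tab n) = T
    rw [Equiv.symm_apply_apply]
  obtain ⟨v, hv⟩ := exists_tabHom P μ i w
  refine ⟨DirectSum.of _ μ (DirectSum.of _ i v), ?_⟩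
  rw [schurSumHom, sumHom_of, sumHom_of, hv, hi]

/-- The image of a central element that annihilates the Young symmetrizers of some shapes and
divides the others. -/
theorem range_schurSumHom (P : YoungDiagram → Prop) (a : PermAlg (Fin n))
    (hc : ∀ x, x * a = a * x) (h0 : ∀ T : Tab n, ¬ P T.1.1 → a * T.young = 0)
    (h1 : ∀ T : Tab n, P T.1.1 → ∃ y, T.young = a * y) (t : Tensor n (Fin n)) :
    (∃ w, act n a w = t) ↔ ∃ x, schurSumHom n P x = t := by
  classical
  constructor
  · rintro ⟨w, rfl⟩
    obtain ⟨y, hy⟩ := Tab.exists_sum_young (1 : PermAlg (Fin n))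
    -- Write `a = ∑_T a c_T y_T`: the excluded shapes contribute zero, and for the others centrality
    -- moves `c_T` to the front.
    have h : ∀ T : Tab n, ∃ x, schurSumHom n P x = act n (a * T.young * y T) w := by
      intro T
      by_cases hT : P T.1.1
      · obtain ⟨x, hx⟩ := exists_schurSumHom_eq P T hT (act n (a * y T) w)
        refine ⟨x, ?_⟩
        rw [hx, ← Module.End.mul_apply, ← map_mul, ← mul_assoc, hc]
      · exact ⟨0, by rw [h0 T hT, zero_mul, map_zero, map_zero, LinearMap.zero_apply]⟩
    choose x hx using h
    refine ⟨∑ T, x T, ?_⟩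
    rw [map_sum, Finset.sum_congr rfl fun T _ => hx T, ← LinearMap.sum_apply, ← map_sum]
    simp only [mul_assoc, ← Finset.mul_sum]
    rw [← hy, mul_one]
  · rintro ⟨x, rfl⟩
    change schurSumHom n P x ∈ LinearMap.range (act n a)
    induction x using DirectSum.induction_on with
    | zero => rw [map_zero]; exact zero_mem _
    | add x y hx hy => rw [map_add]; exact add_mem hx hy
    | of μ x =>
      rw [schurSumHom, sumHom_of]
      induction x using DirectSum.induction_on with
      | zero => rw [map_zero]; exact zero_mem _
      | add x y hx hy => rw [map_add]; exact add_mem hx hy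
      | of i v =>
        rw [sumHom_of]
        obtain ⟨w, hw⟩ := exists_act_tabOf P μ i v
        obtain ⟨y, hy⟩ := h1 (tabOf P μ i) μ.2.2
        rw [hw, hy, map_mul]
        exact ⟨act n y w, rfl⟩

end Decomposition

end AlphaDet

namespace AlphaDet

open Equiv MonoidAlgebra

/-! ### Tensors as polynomials -/

section Polynomials

variable {n : ℕ}

/-- The linear form in the variables of the column `j` with given coefficients. -/
noncomputable def colForm (j : Fin n) : (Fin n → ℂ) →ₗ[ℂ] Poly n :=
  Fintype.linearCombination ℂ fun i => MvPolynomial.X (i, j)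

theorem colForm_apply (j : Fin n) (v : Fin n → ℂ) :
    colForm j v = ∑ i, v i • (MvPolynomial.X (i, j) : Poly n) :=
  Fintype.linearCombination_apply ℂ _ _

theorem colForm_single (i j : Fin n) :
    colForm j (Pi.single i 1) = (MvPolynomial.X (i, j) : Poly n) := by
  rw [colForm, Fintype.linearCombination_apply_single, one_smul]

/-- The representation acts on the row index of the variables, so each column spans a copy of the
natural representation. -/
theorem polyDer_colForm (A : gl n) (j : Fin n) (v : Fin n → ℂ) :
    polyDer A (colForm j v) = colForm j (Matrix.toLin' A v) := by
  rw [colForm_apply, colForm_apply, map_sum]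
  simp only [Derivation.map_smul, polyDer_X, Finset.smul_sum, smul_smul, Matrix.toLin'_apply,
    Matrix.mulVec, dotProduct, Finset.sum_smul]
  rw [Finset.sum_comm]
  exact Finset.sum_congr rfl fun i _ => Finset.sum_congr rfl fun a _ => by rw [mul_comm]

theorem derivation_prod {ι : Type*} [DecidableEq ι] (D : Derivation ℂ (Poly n) (Poly n))
    (s : Finset ι) (f : ι → Poly n) :
    D (∏ i ∈ s, f i) = ∑ k ∈ s, ∏ i ∈ s, Function.update f k (D (f k)) i := by
  induction s using Finset.induction_on with
  | empty => simp
  | insert a s ha ih =>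
    rw [Finset.prod_insert ha, D.leibniz, ih, Finset.sum_insert ha, Finset.prod_insert ha,
      Function.update_self, add_comm, smul_eq_mul, smul_eq_mul, Finset.mul_sum]
    congr 1
    · rw [mul_comm]
      congr 1
      refine Finset.prod_congr rfl fun i hi => ?_
      rw [Function.update_of_ne]
      rintro rfl
      exact ha hi
    · refine Finset.sum_congr rfl fun k hk => ?_
      rw [Finset.prod_insert ha, Function.update_of_ne]
      rintro rfl
      exact ha hk

/-- The embedding of the tensors into the polynomials that sends `e_{i₁} ⊗ ⋯ ⊗ e_{iₙ}` to
`x_{i₁ 1} ⋯ x_{iₙ n}`. -/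
noncomputable def toPolyLin (n : ℕ) : Tensor n (Fin n) →ₗ[ℂ] Poly n :=
  PiTensorProduct.lift ((MultilinearMap.mkPiAlgebra ℂ (Fin n) (Poly n)).compLinearMap colForm)

theorem toPolyLin_tprod (v : Fin n → Fin n → ℂ) :
    toPolyLin n (PiTensorProduct.tprod ℂ v) = ∏ j, colForm j (v j) := by
  rw [toPolyLin, PiTensorProduct.lift.tprod]
  rfl

theorem tensorRep_tprod {ι : Type} [Fintype ι] [DecidableEq ι] (A : gl n) (v : ι → Fin n → ℂ) :
    tensorRep n ι A (PiTensorProduct.tprod ℂ v)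
      = ∑ k, PiTensorProduct.tprod ℂ (Function.update v k (Matrix.toLin' A (v k))) := by
  change (∑ k, PiTensorProduct.map (Pi.mulSingle k (Matrix.toLin' A)))
    (PiTensorProduct.tprod ℂ v) = _
  rw [LinearMap.sum_apply]
  refine Finset.sum_congr rfl fun k _ => ?_
  rw [PiTensorProduct.map_tprod]
  congr 1
  funext l
  by_cases h : l = k
  · subst h; simp
  · rw [Pi.mulSingle_eq_of_ne h, Function.update_of_ne h]
    rfl

theorem toPolyLin_tensorRep (A : gl n) (t : Tensor n (Fin n)) :
    toPolyLin n (tensorRep n (Fin n) A t) = rho n A (toPolyLin n t) := by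
  suffices h : toPolyLin n ∘ₗ tensorRep n (Fin n) A = rho n A ∘ₗ toPolyLin n from
    LinearMap.congr_fun h t
  refine PiTensorProduct.ext (MultilinearMap.ext fun v => ?_)
  change toPolyLin n (tensorRep n (Fin n) A (PiTensorProduct.tprod ℂ v))
    = polyDer A (toPolyLin n (PiTensorProduct.tprod ℂ v))
  rw [tensorRep_tprod, map_sum, toPolyLin_tprod, derivation_prod]
  refine Finset.sum_congr rfl fun k _ => ?_
  rw [toPolyLin_tprod]
  refine Finset.prod_congr rfl fun l _ => ?_
  by_cases h : l = k
  · subst h; rw [Function.update_self, Function.update_self, polyDer_colForm]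
  · rw [Function.update_of_ne h, Function.update_of_ne h]

/-- `toPolyLin` as a morphism of Lie modules. -/
noncomputable def toPoly (n : ℕ) : Tensor n (Fin n) →ₗ⁅ℂ, gl n⁆ Poly n where
  toLinearMap := toPolyLin n
  map_lie' := fun {A t} => toPolyLin_tensorRep A t

/-- The standard basis of the tensors. -/
noncomputable def stdBasis (n : ℕ) : Module.Basis (Fin n → Fin n) ℂ (Tensor n (Fin n)) :=
  Basis.piTensorProduct fun _ => Pi.basisFun ℂ (Fin n)

theorem stdBasis_apply (p : Fin n → Fin n) :
    stdBasis n p = PiTensorProduct.tprod ℂ fun j => (Pi.single (p j) 1 : Fin n → ℂ) := by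
  rw [stdBasis, Basis.piTensorProduct_apply]
  simp [Pi.basisFun_apply]

theorem toPolyLin_stdBasis (p : Fin n → Fin n) :
    toPolyLin n (stdBasis n p) = ∏ j, (MvPolynomial.X (p j, j) : Poly n) := by
  rw [stdBasis_apply, toPolyLin_tprod]
  exact Finset.prod_congr rfl fun j _ => colForm_single _ _

/-- Distinct basis tensors go to distinct monomials, since the exponent of `x_{a j}` tells whether
`p j = a`. -/
theorem toPolyLin_injective : Function.Injective (toPolyLin n) := by
  let m : (Fin n → Fin n) → (Fin n × Fin n →₀ ℕ) := fun p => ∑ j, Finsupp.single (p j, j) 1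
  have hm : Function.Injective m := by
    have hval : ∀ p j a, m p (a, j) = if p j = a then 1 else 0 := by
      intro p j a
      simp only [m, Finsupp.coe_finsetSum, Finset.sum_apply, Finsupp.single_apply, Prod.mk.injEq]
      rw [Finset.sum_eq_single j]
      · simp
      · intro k _ hk
        simp [hk]
      · simp
    intro p q h
    funext j
    have h1 := hval q j (p j)
    rw [← h, hval, if_pos rfl] at h1
    by_contra hne
    rw [if_neg (Ne.symm hne)] at h1
    exact one_ne_zero h1
  have hli : LinearIndependent ℂ fun p => toPolyLin n (stdBasis n p) := by
    have he : (fun p => toPolyLin n (stdBasis n p))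
        = MvPolynomial.basisMonomials (Fin n × Fin n) ℂ ∘ m := by
      funext p
      rw [toPolyLin_stdBasis, Function.comp_apply, MvPolynomial.coe_basisMonomials]
      exact (MvPolynomial.monomial_sum_one _ _).symm
    rw [he]
    exact (MvPolynomial.basisMonomials (Fin n × Fin n) ℂ).linearIndependent.comp m hm
  rw [← LinearMap.ker_eq_bot, LinearMap.ker_eq_bot']
  intro t ht
  rw [← (stdBasis n).sum_repr t, map_sum] at ht
  simp only [map_smul] at ht
  have h := Fintype.linearIndependent_iff.mp hli _ ht
  refine (stdBasis n).ext_elem fun p => ?_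
  rw [h p]
  simp

/-- The permutation `σ` sends `e₁ ⊗ ⋯ ⊗ eₙ` to the tensor with factor `e_{σ⁻¹(k)}` at place `k`;
substituting `k = σ(i)` gives the monomial of the `α`-determinant. -/
theorem toPolyLin_act_alphaElt (α : ℂ) :
    toPolyLin n (act n (alphaElt n α) (stdBasis n id))
      = alphaDet α (Matrix.mvPolynomialX (Fin n) (Fin n) ℂ) := by
  rw [alphaElt, alphaDet]
  simp only [map_sum, map_smul, LinearMap.sum_apply, LinearMap.smul_apply, act_single]
  refine Finset.sum_congr rfl fun σ _ => ?_
  rw [stdBasis_apply, permute_tprod, toPolyLin_tprod]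
  congr 1
  refine (Equiv.prod_comp σ _).symm.trans (Finset.prod_congr rfl fun i _ => ?_)
  rw [colForm_single, Matrix.mvPolynomialX_apply]
  simp

theorem tensorRep_single_stdBasis (a c : Fin n) (p : Fin n → Fin n) :
    tensorRep n (Fin n) (Matrix.single a c 1) (stdBasis n p)
      = ∑ k, if p k = c then stdBasis n (Function.update p k a) else 0 := by
  rw [stdBasis_apply, tensorRep_tprod]
  refine Finset.sum_congr rfl fun k _ => ?_
  have h : Matrix.toLin' (Matrix.single a c (1 : ℂ)) (Pi.single (p k) 1)
      = if p k = c then Pi.single a 1 else 0 := by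
    rw [Matrix.toLin'_apply, Matrix.mulVec_single_one]
    funext i
    split_ifs with h
    · subst h
      simp [Matrix.single_apply, Pi.single_apply, eq_comm]
    · simp [Ne.symm h]
  rw [h]
  split_ifs with hk
  · rw [stdBasis_apply]
    congr 1
    funext l
    by_cases hl : l = k
    · subst hl; simp
    · rw [Function.update_of_ne hl, Function.update_of_ne hl]
  · exact MultilinearMap.map_coord_zero _ k (Function.update_self ..)

/-- The tensor `e₁ ⊗ ⋯ ⊗ eₙ` generates the module of tensors. -/
theorem eq_top_of_stdBasis_id_mem (K : Submodule ℂ (Tensor n (Fin n)))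
    (h0 : stdBasis n id ∈ K) (hK : ∀ A t, t ∈ K → tensorRep n (Fin n) A t ∈ K) : K = ⊤ := by
  have h : ∀ m ≤ n, ∀ p : Fin n → Fin n, (∀ i : Fin n, m ≤ i → p i = i) → stdBasis n p ∈ K := by
    intro m
    induction m with
    | zero =>
      intro _ p hp
      have : p = id := funext fun i => hp i (Nat.zero_le _)
      rwa [this]
    | succ m ih =>
      intro hm p hp
      let x : Fin n := ⟨m, hm⟩
      -- Resetting place `x` to `x` gives a tensor already in `K`. Applying `E_{p(x), x}` restores
      -- `p` in the term of place `x`; every other term changes an earlier place only and lies in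
      -- `K` by induction.
      let q := Function.update p x x
      have hq : ∀ i : Fin n, m ≤ i → q i = i := by
        intro i hi
        by_cases hix : i = x
        · rw [hix]; exact Function.update_self ..
        · have : (i : ℕ) ≠ m := fun h => hix (Fin.ext h)
          exact (Function.update_of_ne hix _ _).trans (hp i (by omega))
      have h1 := hK (Matrix.single (p x) x 1) _ (ih (by omega) q hq)
      rw [tensorRep_single_stdBasis, ← Finset.add_sum_erase _ _ (Finset.mem_univ x),
        if_pos (hq x le_rfl)] at h1
      have h2 : Function.update q x (p x) = p := by
        rw [Function.update_idem, Function.update_eq_self]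
      rw [h2] at h1
      refine (Submodule.add_mem_iff_left K (Submodule.sum_mem K fun k hk => ?_)).mp h1
      have hkx : k ≠ x := Finset.ne_of_mem_erase hk
      split_ifs with hqk
      · refine ih (by omega) _ fun i hi => ?_
        have hik : i ≠ k := by
          rintro rfl
          exact hkx ((hq i hi).symm.trans hqk)
        rw [Function.update_of_ne hik, hq i hi]
      · exact K.zero_mem
  rw [eq_top_iff, ← (stdBasis n).span_eq, Submodule.span_le]
  rintro _ ⟨p, rfl⟩
  exact h n le_rfl p fun i hi => absurd i.2 (by omega)

theorem lift_toPolyLin (u : UniversalEnvelopingAlgebra ℂ (gl n)) (t : Tensor n (Fin n)) :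
    UniversalEnvelopingAlgebra.lift ℂ (rho n) u (toPolyLin n t)
      = toPolyLin n (UniversalEnvelopingAlgebra.lift ℂ (tensorRep n (Fin n)) u t) := by
  obtain ⟨x, rfl⟩ : ∃ x, UniversalEnvelopingAlgebra.mkAlgHom ℂ (gl n) x = u :=
    Quotient.exists_rep u
  induction x using TensorAlgebra.induction generalizing t with
  | algebraMap r => simp [Algebra.algebraMap_eq_smul_one]
  | ι A =>
    have h : UniversalEnvelopingAlgebra.mkAlgHom ℂ (gl n) (TensorAlgebra.ι ℂ A)
      = UniversalEnvelopingAlgebra.ι ℂ A := rfl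
    rw [h, UniversalEnvelopingAlgebra.lift_ι_apply, UniversalEnvelopingAlgebra.lift_ι_apply,
      toPolyLin_tensorRep]
  | mul x y hx hy => simp only [map_mul, Module.End.mul_apply, hx, hy]
  | add x y hx hy => simp only [map_add, LinearMap.add_apply, hx, hy]

theorem lift_act (u : UniversalEnvelopingAlgebra ℂ (gl n)) (a : PermAlg (Fin n))
    (t : Tensor n (Fin n)) :
    UniversalEnvelopingAlgebra.lift ℂ (tensorRep n (Fin n)) u (act n a t)
      = act n a (UniversalEnvelopingAlgebra.lift ℂ (tensorRep n (Fin n)) u t) := by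
  obtain ⟨x, rfl⟩ : ∃ x, UniversalEnvelopingAlgebra.mkAlgHom ℂ (gl n) x = u :=
    Quotient.exists_rep u
  induction x using TensorAlgebra.induction generalizing t with
  | algebraMap r => simp [Algebra.algebraMap_eq_smul_one]
  | ι A =>
    have h : UniversalEnvelopingAlgebra.mkAlgHom ℂ (gl n) (TensorAlgebra.ι ℂ A)
      = UniversalEnvelopingAlgebra.ι ℂ A := rfl
    rw [h, UniversalEnvelopingAlgebra.lift_ι_apply, act_tensorRep]
  | mul x y hx hy => simp only [map_mul, Module.End.mul_apply, hx, hy]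
  | add x y hx hy => simp only [map_add, LinearMap.add_apply, hx, hy]

theorem exists_lift_stdBasis (t : Tensor n (Fin n)) :
    ∃ u, UniversalEnvelopingAlgebra.lift ℂ (tensorRep n (Fin n)) u (stdBasis n id) = t := by
  let F : UniversalEnvelopingAlgebra ℂ (gl n) →ₗ[ℂ] Tensor n (Fin n) :=
    (LinearMap.applyₗ (stdBasis n id)) ∘ₗ
      (UniversalEnvelopingAlgebra.lift ℂ (tensorRep n (Fin n))).toLinearMap
  have h : LinearMap.range F = ⊤ := by
    refine eq_top_of_stdBasis_id_mem _ ⟨1, by simp [F]⟩ ?_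
    rintro A _ ⟨u, rfl⟩
    refine ⟨UniversalEnvelopingAlgebra.ι ℂ A * u, ?_⟩
    change UniversalEnvelopingAlgebra.lift ℂ (tensorRep n (Fin n)) _ _ = _
    rw [map_mul, UniversalEnvelopingAlgebra.lift_ι_apply]
    rfl
  exact LinearMap.range_eq_top.mp h t

/-- The enveloping algebra commutes with `act` and with `toPolyLin`, and its orbit of `e₁ ⊗ ⋯ ⊗ eₙ`
is the whole tensor power. -/
theorem mem_cyclicModule (α : ℂ) (q : Poly n) :
    q ∈ cyclicModule n α ↔ ∃ t, (∃ w, act n (alphaElt n α) w = t) ∧ toPolyLin n t = q := by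
  constructor
  · rintro ⟨u, rfl⟩
    refine ⟨_, ⟨UniversalEnvelopingAlgebra.lift ℂ (tensorRep n (Fin n)) u (stdBasis n id), rfl⟩, ?_⟩
    rw [← lift_act, ← lift_toPolyLin, toPolyLin_act_alphaElt]
  · rintro ⟨_, ⟨w, rfl⟩, rfl⟩
    obtain ⟨u, rfl⟩ := exists_lift_stdBasis w
    refine ⟨u, ?_⟩
    rw [← toPolyLin_act_alphaElt, lift_toPolyLin, lift_act]

theorem nonempty_cyclicModule_equiv (P : YoungDiagram → Prop) (α : ℂ)
    (h0 : ∀ T : Tab n, ¬ P T.1.1 → alphaElt n α * T.young = 0)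
    (h1 : ∀ T : Tab n, P T.1.1 → ∃ y, T.young = alphaElt n α * y) :
    Nonempty (cyclicModule n α ≃ₗ⁅ℂ, gl n⁆ schurSum n P) := by
  refine nonempty_equiv_of_injective ((toPoly n).comp (schurSumHom n P)) ?_ _ fun q => ?_
  · exact toPolyLin_injective.comp (schurSumHom_injective P)
  · rw [mem_cyclicModule]
    simp only [range_schurSumHom P _ (alphaElt_central α) h0 h1]
    constructor
    · rintro ⟨_, ⟨x, rfl⟩, rfl⟩
      exact ⟨x, rfl⟩
    · rintro ⟨x, rfl⟩
      exact ⟨_, ⟨x, rfl⟩, rfl⟩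

/-- The decomposition of the tensor power into Schur modules. -/
theorem nonempty_tensor_equiv :
    Nonempty (Tensor n (Fin n) ≃ₗ⁅ℂ, gl n⁆ schurSum n fun _ => True) := by
  have hs : Function.Surjective (schurSumHom n fun _ => True) := fun t =>
    (range_schurSumHom (fun _ => True) 1 (fun x => by rw [mul_one, one_mul])
      (fun T h => absurd trivial h) (fun T _ => ⟨T.young, (one_mul _).symm⟩) t).mp
      ⟨t, by rw [map_one]; rfl⟩
  let e := Equiv.ofBijective _ ⟨schurSumHom_injective (n := n) fun _ => True, hs⟩
  exact ⟨LieModuleEquiv.symm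
    { schurSumHom n (fun _ => True) with
      invFun := e.symm
      left_inv := e.left_inv
      right_inv := e.right_inv }⟩

end Polynomials

end AlphaDet

/-! ### The decomposition theorem -/

theorem theorem1p1 (n : ℕ) :
    (∀ k : ℕ, 1 ≤ k → k < n →
      Nonempty (AlphaDet.cyclicModule n (1 / (k : ℂ)) ≃ₗ⁅ℂ, AlphaDet.gl n⁆
        AlphaDet.schurSum n (fun μ => μ.colLen 0 ≤ k)) ∧
      Nonempty (AlphaDet.cyclicModule n (-(1 / (k : ℂ))) ≃ₗ⁅ℂ, AlphaDet.gl n⁆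
        AlphaDet.schurSum n (fun μ => μ.rowLen 0 ≤ k))) ∧
    (∀ α : ℂ, (∀ k : ℕ, 1 ≤ k → k < n → α ≠ 1 / (k : ℂ) ∧ α ≠ -(1 / (k : ℂ))) →
      Nonempty (AlphaDet.cyclicModule n α ≃ₗ⁅ℂ, AlphaDet.gl n⁆
        AlphaDet.Tensor n (Fin n)) ∧
      Nonempty (AlphaDet.Tensor n (Fin n) ≃ₗ⁅ℂ, AlphaDet.gl n⁆
        AlphaDet.schurSum n (fun _ => True))) := by
  refine ⟨fun k hk _ => ⟨?_, ?_⟩, fun α hα => ?_⟩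
  · refine AlphaDet.nonempty_cyclicModule_equiv _ _ (fun T hT => ?_) (fun T hT => ?_)
    · exact T.alphaElt_pos_mul_young_eq_zero k hk (not_le.mp hT)
    · exact T.exists_young_eq _ (T.alphaElt_pos_injective k hk hT)
  · refine AlphaDet.nonempty_cyclicModule_equiv _ _ (fun T hT => ?_) (fun T hT => ?_)
    · exact T.alphaElt_neg_mul_young_eq_zero k hk (not_le.mp hT)
    · exact T.exists_young_eq _ (T.alphaElt_neg_injective k hk hT)
  · obtain ⟨e⟩ := AlphaDet.nonempty_tensor_equiv (n := n)
    -- A unit divides every Young symmetrizer, so no shape is excluded.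
    obtain ⟨u, hu⟩ := AlphaDet.isUnit_alphaElt α hα
    obtain ⟨e'⟩ := AlphaDet.nonempty_cyclicModule_equiv (n := n) (fun _ => True) α
      (fun T h => absurd trivial h)
      (fun T _ => ⟨u⁻¹ * T.young, by rw [← hu, Units.mul_inv_cancel_left]⟩)
    exact ⟨⟨e'.trans e.symm⟩, ⟨e⟩⟩
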